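/- Let $\mathbb F_q$ be a finite field, $\theta:\mathbb F_q^+\to\mathbb C^\times$ a nontrivial homomorphism and $n$ a nonnegative integer. Write $[[n]]=\{(i,j):1\le i<j\le n\}$. \textbf{Posets.} A poset on $[n]=\{1,\dots,n\}$ is a subset $\mathcal P\subset[[n]]$ such that $(i,j),(j,k)\in\mathcal P$ implies $(i,k)\in\mathcal P$. Its set of covers $\mathcal P^{\rm cov}$ consists of the $(i,k)\in\mathcal P$ for which there is no $j$ with $(i,j),(j,k)\in\mathcal P$. We write $\mathcal P\vartriangleleft[[n]]$ if $(j,k)\in\mathcal P$ implies $(i,l)\in\mathcal P$ whenever $1\le i\le j<k\le l\le n$. An $\mathbb F_q$-labeled poset is a poset $\mathcal Q$ with a map $\mathcal Q^{\rm cov}\to\mathbb F_q^\times$; the label of $(i,j)\in\mathcal Q^{\rm cov}$ is $\mathcal Q_{ij}$, and $\mathcal Q_{ij}=0$ for $(i,j)\notin\mathcal Q^{\rm cov}$. A set $S\subset\mathcal Q^{\rm cov}$ is independent if no two of its elements share a first or a second coordinate; $\mathcal Q^{\rm cov}_{\rm h}$ is the unique independent set $S\subset\mathcal Q^{\rm cov}$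 for which the weakly decreasing sequence of the numbers $j-i$, $(i,j)\in S$, padded with zeros, is lexicographically maximal. A poset $\mathcal Q\subset\mathcal P$ is $\mathcal P$-representative if $(i,k)\in\mathcal Q^{\rm cov}_{\rm h}$ and $(i,j)\in\mathcal Q^{\rm cov}$ imply $(j,k)\notin\mathcal P$, and $(i,k)\in\mathcal Q^{\rm cov}_{\rm h}$ and $(j,k)\in\mathcal Q^{\rm cov}$ imply $(i,j)\notin\mathcal P$. A labeled poset is $\mathcal P$-representative if its underlying poset is. \textbf{Supercharacters.} Let $\mathfrak n_{\mathcal P}$ be the algebra of $n\times n$ matrices over $\mathbb F_q$ supported in $\mathcal P$, $U_{\mathcal P}=1+\mathfrak n_{\mathcal P}$, and let $U_{\mathcal P}$ act on the dual space $\mathfrak n_{\mathcal P}^*$ by $g\lambda(X)=\lambda(g^{-1}X)$ and $\lambda g(X)=\lambda(Xg^{-1})$. The supercharacters of $U_{\mathcal P}$ are the functions $$\chi^\lambda_{\mathcal P}(g)=\frac{|U_{\mathcal P}\lambda|}{|U_{\mathcal P}\lambda U_{\mathcal P}|}\sum_{\mu\in U_{\mathcal P}\lambda U_{\mathcal P}}\theta(\mu(g-1)),\qquad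 \lambda\in\mathfrak n_{\mathcal P}^*,$$ and $\chi(1)$ is the degree of $\chi$. For $\lambda\in\mathfrak n_{\mathcal P}^*$ put $\lambda_{ij}=\lambda(e_{ij})$ if $(i,j)\in\mathcal P$, $\lambda_{ij}=0$ otherwise, and ${\rm supp}(\lambda)=\{(i,j):\lambda_{ij}\ne0\}$; let $\mathscr S^*_{\mathcal P}$ be the set of $\lambda\in\mathfrak n_{\mathcal P}^*$ whose support has at most one position in each row and each column. \textbf{The correspondence.} For $\lambda\in\mathscr S^*_{\mathcal P}$ and $\mathcal R\in\{\mathcal P,[[n]]\}$ let $${\rm coadj}^{\rm L}_{\mathcal R}(\lambda)=\{(j,k)\in\mathcal P:\exists\,(i,k)\in{\rm supp}(\lambda),\ (i,j)\in\mathcal R\},\qquad {\rm coadj}^{\rm R}_{\mathcal R}(\lambda)=\{(i,j)\in\mathcal P:\exists\,(i,k)\in{\rm supp}(\lambda),\ (j,k)\in\mathcal R\},$$ ${\rm coadj}_{\mathcal R}={\rm coadj}^{\rm L}_{\mathcal R}\cup{\rm coadj}^{\rm R}_{\mathcal R}$, and ${\rm coaux}^{\bullet}(\lambda)={\rm coadj}^{\bullet}_{[[n]]}(\lambda)\setminus{\rm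 coadj}^{\bullet}_{\mathcal P}(\lambda)$ for $\bullet={\rm L},{\rm R}$ or no superscript. For $\eta\in\mathfrak n_{\mathcal P}^*$ with ${\rm supp}(\eta)\subset{\rm coaux}(\lambda)$ write $\eta=\eta'+\eta''$ with ${\rm supp}(\eta')\subset{\rm coaux}^{\rm L}(\lambda)$ and ${\rm supp}(\eta'')\subset{\rm coaux}^{\rm R}(\lambda)\setminus{\rm coaux}^{\rm L}(\lambda)$, and let $\chi^{(\lambda,\eta)}_{\mathcal P}=\chi_{\mathcal P}^{\lambda+\mathfrak R}$, where $\mathfrak R\in\mathfrak n_{\mathcal P}^*$ is given by $$\mathfrak R_{jk}=\eta'_{jk}+\eta''_{jk}+\sum_{i<j<k<l,\ (i,l)\in{\rm supp}(\lambda)}\eta'_{jl}\,\eta''_{ik}\,\lambda_{il}^{-1}\qquad((j,k)\in\mathcal P).$$ A supercharacter $\chi$ of $U_{\mathcal P}$ corresponds to the labeled poset $\mathcal Q$ if there are such $\lambda,\eta$ with $\chi=\chi_{\mathcal P}^{(\lambda,\eta)}$, $\mathcal Q^{\rm cov}={\rm supp}(\lambda+\eta)$ and $\mathcal Q_{ij}=(\lambda+\eta)_{ij}$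 for all $i,j$. \textbf{Statement.} Let $\mathcal P\vartriangleleft[[n]]$. The correspondence is a bijection between the supercharacters of $U_{\mathcal P}$ and the $\mathcal P$-representative $\mathbb F_q$-labeled posets, and: (a) The poset $\mathcal P$, with any $\mathbb F_q$-labeling, is $\mathcal P$-representative and corresponds to a supercharacter of degree one. (b) A supercharacter of $U_{\mathcal P}$ has degree one if and only if it corresponds to a $\mathcal P$-representative $\mathbb F_q$-labeled poset $\mathcal Q$ with $\mathcal Q^{\rm cov}\subset\mathcal P^{\rm cov}$. -/

import Mathlib

namespace PatternGroup

/-- A poset on `[n]`: a transitive set of positions strictly above the diagonal. -/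
@[ext] structure TriPoset (n : ℕ) where
  rel : Set (Fin n × Fin n)
  lt_of_mem : ∀ i j, (i, j) ∈ rel → i < j
  trans : ∀ i j k, (i, j) ∈ rel → (j, k) ∈ rel → (i, k) ∈ rel

/-- The poset `[[n]]` of all positions strictly above the diagonal. -/
def TriPoset.full (n : ℕ) : TriPoset n where
  rel := {p | p.1 < p.2}
  lt_of_mem := fun _ _ h => h
  trans := fun _ _ _ h h' => lt_trans (Set.mem_ofPred_eq ▸ h) h'

/-- The set of covers of a poset. -/
def TriPoset.cov {n : ℕ} (P : TriPoset n) : Set (Fin n × Fin n) :=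
  {p | p ∈ P.rel ∧ ¬ ∃ j, (p.1, j) ∈ P.rel ∧ (j, p.2) ∈ P.rel}

/-- `P` is normal in `[[n]]`. -/
def TriPoset.IsNormal {n : ℕ} (P : TriPoset n) : Prop :=
  ∀ i j k l : Fin n, i ≤ j → j < k → k ≤ l → (i, l) ∉ P.rel → (j, k) ∉ P.rel

section Groups

variable {F : Type*} [Field F] {n : ℕ}

/-- The algebra of matrices supported in `P`. -/
def nil (F : Type*) [Field F] {n : ℕ} (P : TriPoset n) :
    Submodule F (Matrix (Fin n) (Fin n) F) where
  carrier := {X | ∀ i j, (i, j) ∉ P.rel → X i j = 0}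
  add_mem' := by
    intro X Y hX hY i j h
    simp [hX i j h, hY i j h]
  zero_mem' := by
    intro i j _
    rfl
  smul_mem' := by
    intro c X hX i j h
    simp [hX i j h]

theorem mul_mem_nil {P : TriPoset n} {X Y : Matrix (Fin n) (Fin n) F}
    (hX : X ∈ nil F P) (hY : Y ∈ nil F P) : X * Y ∈ nil F P := by
  intro i k h
  rw [Matrix.mul_apply]
  refine Finset.sum_eq_zero fun j _ => ?_
  by_cases h1 : (i, j) ∈ P.rel
  · by_cases h2 : (j, k) ∈ P.rel
    · exact absurd (P.trans i j k h1 h2) h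
    · rw [hY j k h2, mul_zero]
  · rw [hX i j h1, zero_mul]

/-- Membership in the pattern group: upper triangular, ones on the diagonal, and zero at the
positions above the diagonal outside `P`. -/
def IsPattern (P : TriPoset n) (g : Matrix (Fin n) (Fin n) F) : Prop :=
  (∀ i, g i i = 1) ∧ (∀ i j, j < i → g i j = 0) ∧
    ∀ i j, i < j → (i, j) ∉ P.rel → g i j = 0

theorem isPattern_iff (P : TriPoset n) (g : Matrix (Fin n) (Fin n) F) :
    IsPattern P g ↔ g - 1 ∈ nil F P := by
  constructor
  · rintro ⟨h1, h2, h3⟩ i j h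
    rw [Matrix.sub_apply]
    rcases lt_trichotomy i j with hij | rfl | hij
    · rw [h3 i j hij h, Matrix.one_apply_ne hij.ne, sub_zero]
    · rw [h1 i, Matrix.one_apply_eq, sub_self]
    · rw [h2 i j hij, Matrix.one_apply_ne hij.ne', sub_zero]
  · intro h
    have key : ∀ i j, (i, j) ∉ P.rel → g i j = (1 : Matrix (Fin n) (Fin n) F) i j := by
      intro i j hij
      have := h i j hij
      rwa [Matrix.sub_apply, sub_eq_zero] at this
    refine ⟨fun i => ?_, fun i j hij => ?_, fun i j hij hP => ?_⟩
    · rw [key i i fun h' => lt_irrefl _ (P.lt_of_mem i i h'), Matrix.one_apply_eq]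
    · rw [key i j fun h' => lt_asymm hij (P.lt_of_mem i j h'), Matrix.one_apply_ne hij.ne']
    · rw [key i j hP, Matrix.one_apply_ne hij.ne]

/-- The pattern group `U_P`. -/
def patternGroup (F : Type*) [Field F] [Finite F] {n : ℕ} (P : TriPoset n) :
    Subgroup (GL (Fin n) F) :=
  let S : Submonoid (GL (Fin n) F) :=
    { carrier := {g | IsPattern P (g : Matrix (Fin n) (Fin n) F)}
      one_mem' := by
        rw [Set.mem_ofPred_eq, isPattern_iff, Units.val_one, sub_self]
        exact Submodule.zero_mem _
      mul_mem' := by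
        intro a b ha hb
        rw [Set.mem_ofPred_eq, isPattern_iff] at *
        have e : ((a * b : GL (Fin n) F) : Matrix (Fin n) (Fin n) F) - 1 =
            ((a : Matrix (Fin n) (Fin n) F) - 1) * ((b : Matrix (Fin n) (Fin n) F) - 1) +
              (((a : Matrix (Fin n) (Fin n) F) - 1) +
                ((b : Matrix (Fin n) (Fin n) F) - 1)) := by
          rw [Units.val_mul]
          noncomm_ring
        rw [e]
        exact Submodule.add_mem _ (mul_mem_nil ha hb) (Submodule.add_mem _ ha hb) }
  { S with
    inv_mem' := by
      intro g hg
      have hfin : IsOfFinOrder g := isOfFinOrder_of_finite g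
      have hmem : g ^ (orderOf g - 1) ∈ S := pow_mem (show g ∈ S from hg) _
      have hinv : g⁻¹ = g ^ (orderOf g - 1) := by
        rw [inv_eq_iff_mul_eq_one, ← pow_succ', Nat.sub_add_cancel hfin.orderOf_pos,
          pow_orderOf_eq_one]
      rw [hinv]
      exact hmem }

theorem mem_patternGroup [Finite F] {P : TriPoset n} {g : GL (Fin n) F} :
    g ∈ patternGroup F P ↔ IsPattern P (g : Matrix (Fin n) (Fin n) F) := Iff.rfl

theorem sub_one_mem_nil [Finite F] {P : TriPoset n} (g : patternGroup F P) :
    ((g : GL (Fin n) F) : Matrix (Fin n) (Fin n) F) - 1 ∈ nil F P :=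
  (isPattern_iff P _).1 g.2

/-- The element `g - 1` of the algebra of `P`, for `g` in the pattern group. -/
def subOne [Finite F] {P : TriPoset n} (g : patternGroup F P) : nil F P :=
  ⟨((g : GL (Fin n) F) : Matrix (Fin n) (Fin n) F) - 1, sub_one_mem_nil g⟩

/-- Left multiplication `X ↦ g X` on the algebra of `P`. -/
def mulL [Finite F] {P : TriPoset n} (g : patternGroup F P) : nil F P →ₗ[F] nil F P :=
  (LinearMap.mulLeft F ((g : GL (Fin n) F) : Matrix (Fin n) (Fin n) F)).restrict (by
    intro X hX
    have e : LinearMap.mulLeft F ((g : GL (Fin n) F) : Matrix (Fin n) (Fin n) F) X =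
        (((g : GL (Fin n) F) : Matrix (Fin n) (Fin n) F) - 1) * X + X := by
      rw [LinearMap.mulLeft_apply]
      noncomm_ring
    rw [e]
    exact Submodule.add_mem _ (mul_mem_nil (sub_one_mem_nil g) hX) hX)

/-- Right multiplication `X ↦ X g` on the algebra of `P`. -/
def mulR [Finite F] {P : TriPoset n} (g : patternGroup F P) : nil F P →ₗ[F] nil F P :=
  (LinearMap.mulRight F ((g : GL (Fin n) F) : Matrix (Fin n) (Fin n) F)).restrict (by
    intro X hX
    have e : LinearMap.mulRight F ((g : GL (Fin n) F) : Matrix (Fin n) (Fin n) F) X =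
        X * (((g : GL (Fin n) F) : Matrix (Fin n) (Fin n) F) - 1) + X := by
      rw [LinearMap.mulRight_apply]
      noncomm_ring
    rw [e]
    exact Submodule.add_mem _ (mul_mem_nil hX (sub_one_mem_nil g)) hX)

/-- The dual space of the algebra of `P`. -/
abbrev NilDual (F : Type*) [Field F] {n : ℕ} (P : TriPoset n) := Module.Dual F (nil F P)

/-- The left action `(g λ)(X) = λ(g⁻¹ X)`. -/
def actL [Finite F] {P : TriPoset n} (g : patternGroup F P) (lam : NilDual F P) : NilDual F P :=
  lam ∘ₗ mulL g⁻¹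

/-- The right action `(λ g)(X) = λ(X g⁻¹)`. -/
def actR [Finite F] {P : TriPoset n} (lam : NilDual F P) (g : patternGroup F P) : NilDual F P :=
  lam ∘ₗ mulR g⁻¹

/-- The left orbit `U_P λ`. -/
def leftOrbit [Finite F] {P : TriPoset n} (lam : NilDual F P) : Set (NilDual F P) :=
  {mu | ∃ g : patternGroup F P, mu = actL g lam}

/-- The two-sided orbit `U_P λ U_P`. -/
def twoSidedOrbit [Finite F] {P : TriPoset n} (lam : NilDual F P) : Set (NilDual F P) :=
  {mu | ∃ g h : patternGroup F P, mu = actR (actL g lam) h}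

/-- The function `χ^λ` on the pattern group. -/
noncomputable def superchar [Finite F] (θ : AddChar F ℂ) {P : TriPoset n} (lam : NilDual F P) :
    patternGroup F P → ℂ := fun g =>
  ((leftOrbit lam).ncard : ℂ) / ((twoSidedOrbit lam).ncard : ℂ) *
    ∑ᶠ mu ∈ twoSidedOrbit lam, θ (mu (subOne g))

/-- The supercharacters of `U_P` are the functions `χ^λ`. -/
def IsSupercharacter [Finite F] (θ : AddChar F ℂ) {P : TriPoset n}
    (χ : patternGroup F P → ℂ) : Prop :=
  ∃ lam : NilDual F P, χ = superchar θ lam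

theorem single_mem_nil {P : TriPoset n} {i j : Fin n} (h : (i, j) ∈ P.rel) :
    Matrix.single i j (1 : F) ∈ nil F P := by
  intro a b hab
  refine Matrix.single_apply_of_ne (i := i) (j := j) (c := (1 : F)) a b ?_
  rintro ⟨rfl, rfl⟩
  exact hab h

open Classical in
/-- The coordinate `λ_{ij}` of a functional: `λ(e_{ij})` if `(i, j) ∈ P`, and `0` otherwise. -/
noncomputable def coord {P : TriPoset n} (lam : NilDual F P) (i j : Fin n) : F :=
  if h : (i, j) ∈ P.rel then lam ⟨Matrix.single i j 1, single_mem_nil h⟩ else 0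

/-- The support of a functional. -/
def supp {P : TriPoset n} (lam : NilDual F P) : Set (Fin n × Fin n) :=
  {p | p ∈ P.rel ∧ coord lam p.1 p.2 ≠ 0}

/-- The functional whose coordinate at each position `(i, j) ∈ P` is `A i j`. -/
def ofMatrix {P : TriPoset n} (A : Fin n → Fin n → F) : NilDual F P where
  toFun X := ∑ i, ∑ j, A i j * (X : Matrix (Fin n) (Fin n) F) i j
  map_add' X Y := by
    simp [mul_add, Finset.sum_add_distrib]
  map_smul' c X := by
    simp [Finset.mul_sum, mul_left_comm]

/-- The functionals that are labeled set partitions: at most one position of the support in each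
row and each column. -/
def IsSetPartition {P : TriPoset n} (lam : NilDual F P) : Prop :=
  (∀ i j k, (i, j) ∈ supp lam → (i, k) ∈ supp lam → j = k) ∧
    ∀ i j k, (i, k) ∈ supp lam → (j, k) ∈ supp lam → i = j

def coadjL {P : TriPoset n} (Q : TriPoset n) (lam : NilDual F P) : Set (Fin n × Fin n) :=
  {p | p ∈ P.rel ∧ ∃ i, (i, p.2) ∈ supp lam ∧ (i, p.1) ∈ Q.rel}

def coadjR {P : TriPoset n} (Q : TriPoset n) (lam : NilDual F P) : Set (Fin n × Fin n) :=
  {p | p ∈ P.rel ∧ ∃ k, (p.1, k) ∈ supp lam ∧ (p.2, k) ∈ Q.rel}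

def coadj {P : TriPoset n} (Q : TriPoset n) (lam : NilDual F P) : Set (Fin n × Fin n) :=
  coadjL Q lam ∪ coadjR Q lam

def coauxL {P : TriPoset n} (lam : NilDual F P) : Set (Fin n × Fin n) :=
  coadjL (TriPoset.full n) lam \ coadjL P lam

def coauxR {P : TriPoset n} (lam : NilDual F P) : Set (Fin n × Fin n) :=
  coadjR (TriPoset.full n) lam \ coadjR P lam

def coaux {P : TriPoset n} (lam : NilDual F P) : Set (Fin n × Fin n) :=
  coadj (TriPoset.full n) lam \ coadj P lam

open Classical in
/-- The functional with the coordinates of `eta` at the positions in `S` and zero elsewhere. -/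
noncomputable def restrictTo {P : TriPoset n} (eta : NilDual F P) (S : Set (Fin n × Fin n)) :
    NilDual F P :=
  ofMatrix fun i j => if (i, j) ∈ S then coord eta i j else 0

open Classical in
/-- The bilinear product `η *_λ μ`. -/
noncomputable def starProd {P : TriPoset n} (lam eta mu : NilDual F P) : NilDual F P :=
  ofMatrix fun j k => coord eta j k + coord mu j k +
    ∑ p : Fin n × Fin n, if p.1 < j ∧ j < k ∧ k < p.2 ∧ p ∈ supp lam then
      coord eta j p.2 * coord mu p.1 k * (coord lam p.1 p.2)⁻¹ else 0

/-- The element `R*_λ(η)`: the product `*_λ` of the part of `η` on `coauxL λ` and the part on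
`coauxR λ \ coauxL λ`. -/
noncomputable def frakR {P : TriPoset n} (lam eta : NilDual F P) : NilDual F P :=
  starProd lam (restrictTo eta (coauxL lam)) (restrictTo eta (coauxR lam \ coauxL lam))

/-- The supercharacter `χ^{(λ,η)}`. -/
noncomputable def supercharPair [Finite F] (θ : AddChar F ℂ) {P : TriPoset n}
    (lam eta : NilDual F P) : patternGroup F P → ℂ :=
  superchar θ (lam + frakR lam eta)

end Groups

/-- Independent sets of positions: no two share a first or a second coordinate. -/
def Independent {n : ℕ} (S : Finset (Fin n × Fin n)) : Prop :=
  ∀ p ∈ S, ∀ r ∈ S, p ≠ r → p.1 ≠ r.1 ∧ p.2 ≠ r.2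

/-- The weakly decreasing list of the numbers `j - i`, `(i, j) ∈ S`, followed by zeros. -/
def ell {n : ℕ} (S : Finset (Fin n × Fin n)) (t : ℕ) : ℕ :=
  ((S.val.map fun p => (p.2 : ℕ) - (p.1 : ℕ)).sort (· ≥ ·)).getD t 0

/-- Lexicographic `a ≥ b`. -/
def LexGE (a b : ℕ → ℕ) : Prop :=
  a = b ∨ ∃ t, (∀ s < t, a s = b s) ∧ b t < a t

/-- Highest cover sets: independent sets of covers with lexicographically maximal `ell`. -/
def IsHighestCoverSet {n : ℕ} (Q : TriPoset n) (S : Finset (Fin n × Fin n)) : Prop :=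
  (↑S ⊆ Q.cov ∧ Independent S) ∧
    ∀ T : Finset (Fin n × Fin n), ↑T ⊆ Q.cov → Independent T → LexGE (ell S) (ell T)

/-- The highest cover set of `Q` (there is exactly one). -/
def TriPoset.covh {n : ℕ} (Q : TriPoset n) : Set (Fin n × Fin n) :=
  {p | ∃ S : Finset (Fin n × Fin n), IsHighestCoverSet Q S ∧ p ∈ S}

/-- `Q` is `P`-representative. -/
def IsRepresentative {n : ℕ} (P Q : TriPoset n) : Prop :=
  Q.rel ⊆ P.rel ∧
    (∀ i j k, (i, k) ∈ Q.covh → (i, j) ∈ Q.cov → (j, k) ∉ P.rel) ∧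
    ∀ i j k, (i, k) ∈ Q.covh → (j, k) ∈ Q.cov → (i, j) ∉ P.rel

/-- An `F`-labeled poset on `[n]`: a poset with a nonzero label on each cover. -/
structure LabeledPoset (n : ℕ) (F : Type*) [Field F] where
  poset : TriPoset n
  label : poset.cov → Fˣ

open Classical in
/-- The label of a cover, and zero at all other positions. -/
noncomputable def LabeledPoset.entry {n : ℕ} {F : Type*} [Field F] (Q : LabeledPoset n F)
    (i j : Fin n) : F :=
  if h : (i, j) ∈ Q.poset.cov then (Q.label ⟨(i, j), h⟩ : F) else 0

/-- `Q` is the labeled poset `P^{(λ,η)}`: its covers are the support of `λ + η` and its labels are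
the coordinates of `λ + η`. -/
def IsPosetOf {n : ℕ} {F : Type*} [Field F] {P : TriPoset n} (lam eta : NilDual F P)
    (Q : LabeledPoset n F) : Prop :=
  Q.poset.cov = supp (lam + eta) ∧ ∀ i j, Q.entry i j = coord (lam + eta) i j

/-- The function `χ` on `U_P` corresponds to the labeled poset `Q` under
`χ^{(λ,η)} ↦ (λ,η) ↦ P^{(λ,η)}`. -/
def Corresponds {n : ℕ} {F : Type*} [Field F] [Finite F] (θ : AddChar F ℂ) {P : TriPoset n}
    (χ : patternGroup F P → ℂ) (Q : LabeledPoset n F) : Prop :=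
  ∃ lam eta : NilDual F P, IsSetPartition lam ∧ supp eta ⊆ coaux lam ∧
    χ = supercharPair θ lam eta ∧ IsPosetOf lam eta Q

end PatternGroup

/-! In coordinates the group acts on functionals by `M ↦ aᵀ M bᵀ`, read only at positions of `P`. An
entry of the result depends only on entries weakly above and to the right of it. Since `P` is
normal, these all lie in `P`, so the full unitriangular group acts as well and conjugates `U_P` into
itself.

The functional `λ + R*_λ(η)` equals `act p q λ` on `P` for some full unitriangular `p`, `q`
(`exists_act_eq_add_frakR`). Conjugating by them turns questions about the `U_P`-orbit of `λ +
R*_λ(η)` into questions about that of the set partition `λ`, where they can be read off entry by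
entry. At a position of `coadj P` the entry can be corrected within the orbit. At a position of
`coaux` it cannot, and it is recorded by `η`. At the remaining positions it starts a new entry of
`λ`. Filling the positions in reading order gives a pair in every orbit (`exists_pair_mem_orbit`).
The pair is unique (`pair_unique`): `λ` is already determined by the orbit under the full group, and
two different `η` would make `U_P` change an entry of `λ` outside `coadj P`.

Linear independence of additive characters shows that supercharacters determine their orbits
(`mem_orbit_of_superchar_eq`), so they correspond to pairs `(λ, η)`.

To pass to posets, `covh` is characterised as the set of covers picked greedily by decreasing
length: every other cover shares a row or column with a longer chosen one (`IsDominant`). The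
support of `λ` has this property inside that of `λ + η`, hence is recovered as `covh`
(`covh_eq_supp`); the representativity conditions then say that the other covers avoid `coadj P`.
Finally the degree is the size of the left orbit, which is one exactly when `λ` is supported on
covers of `P`, and normality passes this on to `η`. -/

namespace PatternGroup

/-! ### Coordinates and the two-sided action on matrices -/

section Action

variable {F : Type*} [Field F] {n : ℕ}

/-- The matrix of coordinates of a functional. -/
noncomputable def mat {P : TriPoset n} (lam : NilDual F P) : Matrix (Fin n) (Fin n) F :=
  Matrix.of fun i j => coord lam i j

@[simp] theorem mat_apply {P : TriPoset n} (lam : NilDual F P) (i j : Fin n) :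
    mat lam i j = coord lam i j := rfl

theorem coord_of_notMem {P : TriPoset n} (lam : NilDual F P) {i j : Fin n}
    (h : (i, j) ∉ P.rel) : coord lam i j = 0 := dif_neg h

theorem mem_rel_of_coord_ne {P : TriPoset n} {lam : NilDual F P} {i j : Fin n}
    (h : coord lam i j ≠ 0) : (i, j) ∈ P.rel := by
  by_contra h'
  exact h (coord_of_notMem lam h')

theorem mem_supp {P : TriPoset n} {lam : NilDual F P} {i j : Fin n} :
    (i, j) ∈ supp lam ↔ coord lam i j ≠ 0 :=
  ⟨fun h => h.2, fun h => ⟨mem_rel_of_coord_ne h, h⟩⟩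

theorem coord_add {P : TriPoset n} (lam mu : NilDual F P) (i j : Fin n) :
    coord (lam + mu) i j = coord lam i j + coord mu i j := by
  unfold coord
  split <;> simp

theorem coord_ofMatrix {P : TriPoset n} (A : Fin n → Fin n → F) {i j : Fin n}
    (h : (i, j) ∈ P.rel) : coord (ofMatrix A : NilDual F P) i j = A i j := by
  unfold coord
  rw [dif_pos h]
  change ∑ a, ∑ b, A a b * Matrix.single i j (1 : F) a b = A i j
  simp [Matrix.single_apply, ite_and]

theorem nil_eq_sum {P : TriPoset n} (lam : NilDual F P) (X : nil F P) :
    lam X = ∑ i, ∑ j, coord lam i j * (X : Matrix (Fin n) (Fin n) F) i j := by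
  classical
  have hX : X = ∑ i, ∑ j, if h : (i, j) ∈ P.rel then
      (X : Matrix (Fin n) (Fin n) F) i j •
        (⟨Matrix.single i j 1, single_mem_nil h⟩ : nil F P) else 0 := by
    apply Subtype.ext
    rw [AddSubmonoidClass.coe_finsetSum]
    conv_lhs => rw [Matrix.matrix_eq_sum_single (X : Matrix (Fin n) (Fin n) F)]
    refine Finset.sum_congr rfl fun i _ => ?_
    rw [AddSubmonoidClass.coe_finsetSum]
    refine Finset.sum_congr rfl fun j _ => ?_
    split_ifs with h
    · simp
    · simp [X.2 i j h]
  conv_lhs => rw [hX]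
  rw [map_sum]
  refine Finset.sum_congr rfl fun i _ => ?_
  rw [map_sum]
  refine Finset.sum_congr rfl fun j _ => ?_
  unfold coord
  split_ifs with h
  · rw [map_smul, smul_eq_mul, mul_comm]
  · simp

theorem dual_ext {P : TriPoset n} {lam mu : NilDual F P}
    (h : ∀ i j, (i, j) ∈ P.rel → coord lam i j = coord mu i j) : lam = mu := by
  apply LinearMap.ext
  intro X
  rw [nil_eq_sum, nil_eq_sum]
  refine Finset.sum_congr rfl fun i _ => Finset.sum_congr rfl fun j _ => ?_
  by_cases hij : (i, j) ∈ P.rel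
  · rw [h i j hij]
  · rw [coord_of_notMem _ hij, coord_of_notMem _ hij]

theorem TriPoset.IsNormal.mem {P : TriPoset n} (hP : P.IsNormal) {i j k l : Fin n}
    (h : (j, k) ∈ P.rel) (hij : i ≤ j) (hkl : k ≤ l) : (i, l) ∈ P.rel := by
  by_contra h'
  exact hP i j k l hij (P.lt_of_mem _ _ h) hkl h' h

theorem TriPoset.isNormal_full : (TriPoset.full n).IsNormal := by
  intro i j k l hij hjk hkl h
  exact absurd (lt_of_le_of_lt hij (lt_of_lt_of_le hjk hkl)) h

@[simp] theorem TriPoset.mem_full {i j : Fin n} : (i, j) ∈ (TriPoset.full n).rel ↔ i < j :=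
  Iff.rfl

/-- The two-sided action `M ↦ aᵀ M bᵀ` on coordinate matrices. -/
def act (a b : GL (Fin n) F) (M : Matrix (Fin n) (Fin n) F) : Matrix (Fin n) (Fin n) F :=
  (a : Matrix (Fin n) (Fin n) F).transpose * M * (b : Matrix (Fin n) (Fin n) F).transpose

theorem act_add (a b : GL (Fin n) F) (M N : Matrix (Fin n) (Fin n) F) :
    act a b (M + N) = act a b M + act a b N := by
  simp [act, mul_add, add_mul]

theorem act_sub (a b : GL (Fin n) F) (M N : Matrix (Fin n) (Fin n) F) :
    act a b (M - N) = act a b M - act a b N := by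
  simp [act, mul_sub, sub_mul]

theorem act_act (a b c d : GL (Fin n) F) (M : Matrix (Fin n) (Fin n) F) :
    act a b (act c d M) = act (c * a) (b * d) M := by
  simp [act, Matrix.transpose_mul, Matrix.mul_assoc]

@[simp] theorem act_one (M : Matrix (Fin n) (Fin n) F) : act 1 1 M = M := by
  simp [act]

theorem act_apply (a b : GL (Fin n) F) (M : Matrix (Fin n) (Fin n) F) (j k : Fin n) :
    act a b M j k = ∑ i, ∑ l, (a : Matrix (Fin n) (Fin n) F) i j * M i l *
      (b : Matrix (Fin n) (Fin n) F) k l := by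
  simp only [act, Matrix.mul_apply, Matrix.transpose_apply, Finset.sum_mul]
  exact Finset.sum_comm

/-- Normality makes the algebra of `P` a two-sided ideal under multiplication by upper triangular
matrices; this is the left half. -/
theorem upper_mul_mem_nil {P : TriPoset n} (hP : P.IsNormal) {A X : Matrix (Fin n) (Fin n) F}
    (hA : ∀ i j, j < i → A i j = 0) (hX : X ∈ nil F P) : A * X ∈ nil F P := by
  intro i k h
  rw [Matrix.mul_apply]
  refine Finset.sum_eq_zero fun j _ => ?_
  by_cases hji : j < i
  · rw [hA i j hji, zero_mul]
  · rw [hX j k fun h' => h (hP.mem h' (not_lt.1 hji) le_rfl), mul_zero]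

theorem mul_upper_mem_nil {P : TriPoset n} (hP : P.IsNormal) {A X : Matrix (Fin n) (Fin n) F}
    (hA : ∀ i j, j < i → A i j = 0) (hX : X ∈ nil F P) : X * A ∈ nil F P := by
  intro i k h
  rw [Matrix.mul_apply]
  refine Finset.sum_eq_zero fun j _ => ?_
  by_cases hkj : k < j
  · rw [hA j k hkj, mul_zero]
  · rw [hX i j fun h' => h (hP.mem h' le_rfl (not_lt.1 hkj)), zero_mul]

variable [Finite F]

theorem exists_patternGroup {P : TriPoset n} {g : Matrix (Fin n) (Fin n) F} (hg : IsPattern P g) :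
    ∃ a ∈ patternGroup F P, (a : Matrix (Fin n) (Fin n) F) = g := by
  have hdet : g.det = 1 := by
    rw [Matrix.det_of_isUpperTriangular]
    · exact Finset.prod_eq_one fun i _ => hg.1 i
    · intro i j hij
      exact hg.2.1 i j hij
  refine ⟨Matrix.GeneralLinearGroup.mkOfDetNeZero g (by simp [hdet]), ?_, rfl⟩
  exact hg

theorem patternGroup_le_full (P : TriPoset n) :
    patternGroup F P ≤ patternGroup F (TriPoset.full n) := by
  intro g hg
  rw [mem_patternGroup] at *
  exact ⟨hg.1, hg.2.1, fun i j hij h => absurd hij h⟩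

theorem pattern_eq_zero {P : TriPoset n} {a : GL (Fin n) F} (ha : a ∈ patternGroup F P)
    {i j : Fin n} (hij : i ≠ j) (h : (i, j) ∉ P.rel) :
    (a : Matrix (Fin n) (Fin n) F) i j = 0 := by
  rcases lt_or_gt_of_ne hij with h' | h'
  · exact ha.2.2 i j h' h
  · exact ha.2.1 i j h'

/-- Writing `p g p⁻¹ - 1 = p (g - 1) p⁻¹` reduces this to the ideal property. It is what lets `p`
and `q` be moved past elements of `U_P`. -/
theorem conj_mem_patternGroup {P : TriPoset n} (hP : P.IsNormal) {p g : GL (Fin n) F}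
    (hp : p ∈ patternGroup F (TriPoset.full n)) (hg : g ∈ patternGroup F P) :
    p * g * p⁻¹ ∈ patternGroup F P := by
  have hpi := (patternGroup F (TriPoset.full n)).inv_mem hp
  rw [mem_patternGroup, isPattern_iff] at hg ⊢
  have e : ((p * g * p⁻¹ : GL (Fin n) F) : Matrix (Fin n) (Fin n) F) - 1 =
      (p : Matrix (Fin n) (Fin n) F) * ((g : Matrix (Fin n) (Fin n) F) - 1) *
        ((p⁻¹ : GL (Fin n) F) : Matrix (Fin n) (Fin n) F) := by
    have : (p : Matrix (Fin n) (Fin n) F) * ((p⁻¹ : GL (Fin n) F) : Matrix (Fin n) (Fin n) F) = 1 := by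
      rw [← Units.val_mul, mul_inv_cancel, Units.val_one]
    rw [mul_sub, sub_mul, mul_one, this, Units.val_mul, Units.val_mul]
  rw [e]
  exact mul_upper_mem_nil hP hpi.2.1 (upper_mul_mem_nil hP hp.2.1 hg)

theorem conj_mem_patternGroup' {P : TriPoset n} (hP : P.IsNormal) {p g : GL (Fin n) F}
    (hp : p ∈ patternGroup F (TriPoset.full n)) (hg : g ∈ patternGroup F P) :
    p⁻¹ * g * p ∈ patternGroup F P := by
  simpa using conj_mem_patternGroup hP ((patternGroup F (TriPoset.full n)).inv_mem hp) hg

theorem exists_transvection {P : TriPoset n} {i j : Fin n} (h : (i, j) ∈ P.rel) (t : F) :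
    ∃ a ∈ patternGroup F P,
      (a : Matrix (Fin n) (Fin n) F) = 1 + t • Matrix.single i j (1 : F) := by
  apply exists_patternGroup
  rw [isPattern_iff, add_sub_cancel_left]
  exact Submodule.smul_mem _ _ (single_mem_nil h)

/-- A unitriangular pair does not change an entry when the matrix vanishes at all other entries
weakly above and weakly to the right of it. -/
theorem act_apply_of_vanish {a b : GL (Fin n) F} (ha : a ∈ patternGroup F (TriPoset.full n))
    (hb : b ∈ patternGroup F (TriPoset.full n)) {Z : Matrix (Fin n) (Fin n) F} {j k : Fin n}
    (hZ : ∀ i l, i ≤ j → k ≤ l → (i, l) ≠ (j, k) → Z i l = 0) : act a b Z j k = Z j k := by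
  rw [act_apply, Finset.sum_eq_single j, Finset.sum_eq_single k]
  · rw [ha.1 j, hb.1 k, one_mul, mul_one]
  · intro l _ hl
    by_cases hkl : k ≤ l
    · rw [hZ j l le_rfl hkl (by simpa using hl), mul_zero, zero_mul]
    · rw [hb.2.1 k l (not_le.1 hkl), mul_zero]
  · simp
  · intro i _ hi
    refine Finset.sum_eq_zero fun l _ => ?_
    by_cases hij : i ≤ j
    · by_cases hkl : k ≤ l
      · rw [hZ i l hij hkl (by simp [hi]), mul_zero, zero_mul]
      · rw [hb.2.1 k l (not_le.1 hkl), mul_zero]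
    · rw [ha.2.1 i j (not_le.1 hij), zero_mul, zero_mul]
  · simp

/-- Only entries weakly to the upper right of a position contribute to it: apply
`act_apply_of_vanish` to the difference of the two matrices. -/
theorem act_congr {a b : GL (Fin n) F} (ha : a ∈ patternGroup F (TriPoset.full n))
    (hb : b ∈ patternGroup F (TriPoset.full n)) {M N : Matrix (Fin n) (Fin n) F} {j k : Fin n}
    (h : ∀ i l, i ≤ j → k ≤ l → M i l = N i l) : act a b M j k = act a b N j k := by
  have hZ : ∀ i l, i ≤ j → k ≤ l → (M - N) i l = 0 := fun i l hi hl => by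
    rw [Matrix.sub_apply, h i l hi hl, sub_self]
  have := act_apply_of_vanish ha hb (Z := M - N) (j := j) (k := k) fun i l hi hl _ => hZ i l hi hl
  rw [hZ j k le_rfl le_rfl, act_sub, Matrix.sub_apply, sub_eq_zero] at this
  exact this

/-- The coordinate is `λ(g⁻¹ e_{jk} h⁻¹)`, and the matrix `g⁻¹ e_{jk} h⁻¹` has entry `(g⁻¹)_{ij}
(h⁻¹)_{kl}` at `(i, l)`; hence the transposes in `act`. -/
theorem coord_actR_actL {P : TriPoset n} (lam : NilDual F P)
    (g h : patternGroup F P) {j k : Fin n} (hjk : (j, k) ∈ P.rel) :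
    coord (actR (actL g lam) h) j k =
      act ((g⁻¹ : patternGroup F P) : GL (Fin n) F) ((h⁻¹ : patternGroup F P) : GL (Fin n) F)
        (mat lam) j k := by
  have e : coord (actR (actL g lam) h) j k =
      lam (mulL g⁻¹ (mulR h⁻¹ ⟨Matrix.single j k 1, single_mem_nil hjk⟩)) := by
    unfold coord
    rw [dif_pos hjk]
    rfl
  rw [e, nil_eq_sum, act_apply]
  refine Finset.sum_congr rfl fun i _ => Finset.sum_congr rfl fun l _ => ?_
  have e2 : ((mulL g⁻¹ (mulR h⁻¹ ⟨Matrix.single j k 1, single_mem_nil hjk⟩) : nil F P) :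
      Matrix (Fin n) (Fin n) F) = (((g⁻¹ : patternGroup F P) : GL (Fin n) F) :
        Matrix (Fin n) (Fin n) F) * (Matrix.single j k 1 *
        (((h⁻¹ : patternGroup F P) : GL (Fin n) F) : Matrix (Fin n) (Fin n) F)) := rfl
  have e3 : ∀ A B : Matrix (Fin n) (Fin n) F,
      (A * (Matrix.single j k (1 : F) * B) : Matrix (Fin n) (Fin n) F) i l = A i j * B k l := by
    intro A B
    rw [Matrix.mul_apply, Finset.sum_eq_single j]
    · simp
    · intro b _ hb
      rw [Matrix.single_mul_apply_of_ne _ _ _ _ _ hb, mul_zero]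
    · simp
  rw [e2, e3, mat_apply]
  ring

theorem mem_twoSidedOrbit {P : TriPoset n} {lam mu : NilDual F P} :
    mu ∈ twoSidedOrbit lam ↔ ∃ a ∈ patternGroup F P, ∃ b ∈ patternGroup F P,
      ∀ j k, (j, k) ∈ P.rel → coord mu j k = act a b (mat lam) j k := by
  constructor
  · rintro ⟨g, h, rfl⟩
    exact ⟨_, (g⁻¹).2, _, (h⁻¹).2, fun j k hjk => coord_actR_actL lam g h hjk⟩
  · rintro ⟨a, ha, b, hb, hab⟩
    refine ⟨⟨a, ha⟩⁻¹, ⟨b, hb⟩⁻¹, dual_ext fun j k hjk => ?_⟩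
    rw [coord_actR_actL _ _ _ hjk, inv_inv, inv_inv, hab j k hjk]

theorem coord_actL {P : TriPoset n} (lam : NilDual F P)
    (g : patternGroup F P) {j k : Fin n} (hjk : (j, k) ∈ P.rel) :
    coord (actL g lam) j k =
      act ((g⁻¹ : patternGroup F P) : GL (Fin n) F) 1 (mat lam) j k := by
  have : actL g lam = actR (actL g lam) 1 := by
    apply LinearMap.ext
    intro X
    change actL g lam X = actL g lam (mulR 1⁻¹ X)
    congr 1
    apply Subtype.ext
    change (X : Matrix (Fin n) (Fin n) F) =
      X * (((1⁻¹ : patternGroup F P) : GL (Fin n) F) : Matrix (Fin n) (Fin n) F)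
    simp
  rw [this, coord_actR_actL _ _ _ hjk]
  simp

end Action

/-! ### The functional `λ + R*_λ(η)` as a full unitriangular translate of `λ` -/

section Normal

variable {F : Type*} [Field F] {n : ℕ}

theorem coord_restrictTo {P : TriPoset n} (eta : NilDual F P) (S : Set (Fin n × Fin n))
    [DecidablePred (· ∈ S)] (i j : Fin n) :
    coord (restrictTo eta S) i j = if (i, j) ∈ S then coord eta i j else 0 := by
  by_cases h : (i, j) ∈ P.rel
  · rw [restrictTo, coord_ofMatrix _ h]
    congr
  · rw [coord_of_notMem _ h, coord_of_notMem _ h, ite_self]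

open Classical in
theorem coord_starProd {P : TriPoset n} (lam eta mu : NilDual F P) {j k : Fin n}
    (h : (j, k) ∈ P.rel) : coord (starProd lam eta mu) j k = coord eta j k + coord mu j k +
      ∑ p : Fin n × Fin n, if p.1 < j ∧ j < k ∧ k < p.2 ∧ p ∈ supp lam then
        coord eta j p.2 * coord mu p.1 k * (coord lam p.1 p.2)⁻¹ else 0 := by
  rw [starProd, coord_ofMatrix _ h]

theorem mem_coauxL_iff {P : TriPoset n} {lam : NilDual F P} {j k : Fin n} :
    (j, k) ∈ coauxL lam ↔ (j, k) ∈ P.rel ∧ (∃ i < j, (i, k) ∈ supp lam) ∧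
      ∀ i, (i, k) ∈ supp lam → (i, j) ∉ P.rel := by
  simp only [coauxL, coadjL, Set.mem_sdiff, Set.mem_ofPred_eq, TriPoset.mem_full, not_and,
    not_exists]
  constructor
  · rintro ⟨⟨h1, i, h2, h3⟩, h4⟩
    exact ⟨h1, ⟨i, h3, h2⟩, h4 h1⟩
  · rintro ⟨h1, ⟨i, h3, h2⟩, h4⟩
    exact ⟨⟨h1, i, h2, h3⟩, fun _ => h4⟩

theorem mem_coauxR_iff {P : TriPoset n} {lam : NilDual F P} {i j : Fin n} :
    (i, j) ∈ coauxR lam ↔ (i, j) ∈ P.rel ∧ (∃ k, j < k ∧ (i, k) ∈ supp lam) ∧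
      ∀ k, (i, k) ∈ supp lam → (j, k) ∉ P.rel := by
  simp only [coauxR, coadjR, Set.mem_sdiff, Set.mem_ofPred_eq, TriPoset.mem_full, not_and,
    not_exists]
  constructor
  · rintro ⟨⟨h1, i, h2, h3⟩, h4⟩
    exact ⟨h1, ⟨i, h3, h2⟩, h4 h1⟩
  · rintro ⟨h1, ⟨i, h3, h2⟩, h4⟩
    exact ⟨⟨h1, i, h2, h3⟩, fun _ => h4⟩

theorem mem_coaux_iff {P : TriPoset n} {lam : NilDual F P} {i j : Fin n} :
    (i, j) ∈ coaux lam ↔ (i, j) ∈ P.rel ∧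
      ((∃ h < i, (h, j) ∈ supp lam) ∨ ∃ k, j < k ∧ (i, k) ∈ supp lam) ∧
      (∀ h, (h, j) ∈ supp lam → (h, i) ∉ P.rel) ∧ ∀ k, (i, k) ∈ supp lam → (j, k) ∉ P.rel := by
  simp only [coaux, coadj, coadjL, coadjR, Set.mem_sdiff, Set.mem_union, Set.mem_ofPred_eq,
    TriPoset.mem_full, not_or, not_and, not_exists]
  constructor
  · rintro ⟨⟨h1, i, h2, h3⟩ | ⟨h1, i, h2, h3⟩, h4, h5⟩
    · exact ⟨h1, Or.inl ⟨i, h3, h2⟩, h4 h1, h5 h1⟩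
    · exact ⟨h1, Or.inr ⟨i, h3, h2⟩, h4 h1, h5 h1⟩
  · rintro ⟨h1, ⟨i, h3, h2⟩ | ⟨i, h3, h2⟩, h4, h5⟩
    · exact ⟨Or.inl ⟨h1, i, h2, h3⟩, fun _ => h4, fun _ => h5⟩
    · exact ⟨Or.inr ⟨h1, i, h2, h3⟩, fun _ => h4, fun _ => h5⟩

theorem coaux_subset_union {P : TriPoset n} {lam : NilDual F P} :
    coaux lam ⊆ coauxL lam ∪ coauxR lam := by
  rintro ⟨i, j⟩ h
  rw [mem_coaux_iff] at h
  rw [Set.mem_union, mem_coauxL_iff, mem_coauxR_iff]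
  obtain ⟨h1, h2 | h2, h3, h4⟩ := h
  · exact Or.inl ⟨h1, h2, h3⟩
  · exact Or.inr ⟨h1, h2, h4⟩

theorem notMem_coaux_of_mem_supp {P : TriPoset n} {lam : NilDual F P} (hlam : IsSetPartition lam)
    {p : Fin n × Fin n} (hp : p ∈ supp lam) : p ∉ coaux lam := by
  obtain ⟨i, j⟩ := p
  rw [mem_coaux_iff]
  rintro ⟨-, ⟨h, hi, hh⟩ | ⟨k, hk, hh⟩, -⟩
  · exact hi.ne (hlam.2 _ _ _ hh hp)
  · exact hk.ne (hlam.1 _ _ _ hp hh)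

/-- The transpose of the entrywise inverse of the coordinate matrix. -/
noncomputable def matInv {P : TriPoset n} (lam : NilDual F P) : Matrix (Fin n) (Fin n) F :=
  Matrix.of fun l i => (coord lam i l)⁻¹

/-- For a set partition `matInv λ * mat λ` is the diagonal projection onto the columns that meet the
support, so it fixes every matrix living in those columns. -/
theorem mul_matInv_mul_mat {P : TriPoset n} {lam : NilDual F P} (hlam : IsSetPartition lam)
    {E : Matrix (Fin n) (Fin n) F} (hE : ∀ j k, E j k ≠ 0 → ∃ i, (i, k) ∈ supp lam) :
    E * (matInv lam * mat lam) = E := by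
  ext j k
  rw [Matrix.mul_apply, Finset.sum_eq_single k]
  · by_cases h0 : E j k = 0
    · rw [h0, zero_mul]
    obtain ⟨i, hi⟩ := hE j k h0
    rw [Matrix.mul_apply, Finset.sum_eq_single i]
    · simp only [matInv, Matrix.of_apply, mat_apply]
      rw [inv_mul_cancel₀ (mem_supp.1 hi), mul_one]
    · intro i' _ hi'
      simp only [matInv, Matrix.of_apply, mat_apply]
      have : coord lam i' k = 0 := by
        by_contra h
        exact hi' (hlam.2 _ _ _ (mem_supp.2 h) hi)
      rw [this, mul_zero]
    · simp
  · intro l _ hl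
    rw [Matrix.mul_apply, Finset.sum_eq_zero, mul_zero]
    intro i _
    simp only [matInv, Matrix.of_apply, mat_apply]
    by_contra h
    have h1 : coord lam i l ≠ 0 := fun h' => h (by rw [h', inv_zero, zero_mul])
    have h2 : coord lam i k ≠ 0 := fun h' => h (by rw [h', mul_zero])
    exact hl (hlam.1 _ _ _ (mem_supp.2 h1) (mem_supp.2 h2))
  · simp

theorem mat_mul_matInv_mul {P : TriPoset n} {lam : NilDual F P} (hlam : IsSetPartition lam)
    {E : Matrix (Fin n) (Fin n) F} (hE : ∀ i k, E i k ≠ 0 → ∃ l, (i, l) ∈ supp lam) :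
    (mat lam * matInv lam) * E = E := by
  ext i k
  rw [Matrix.mul_apply, Finset.sum_eq_single i]
  · by_cases h0 : E i k = 0
    · rw [h0, mul_zero]
    obtain ⟨l, hl⟩ := hE i k h0
    rw [Matrix.mul_apply, Finset.sum_eq_single l]
    · simp only [matInv, Matrix.of_apply, mat_apply]
      rw [mul_inv_cancel₀ (mem_supp.1 hl), one_mul]
    · intro l' _ hl'
      simp only [matInv, Matrix.of_apply, mat_apply]
      have : coord lam i l' = 0 := by
        by_contra h
        exact hl' (hlam.1 _ _ _ (mem_supp.2 h) hl)
      rw [this, zero_mul]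
    · simp
  · intro j _ hj
    rw [Matrix.mul_apply, Finset.sum_eq_zero, zero_mul]
    intro l _
    simp only [matInv, Matrix.of_apply, mat_apply]
    by_contra h
    have h1 : coord lam j l ≠ 0 := fun h' => h (by rw [h', inv_zero, mul_zero])
    have h2 : coord lam i l ≠ 0 := fun h' => h (by rw [h', zero_mul])
    exact hj (hlam.2 _ _ _ (mem_supp.2 h1) (mem_supp.2 h2))
  · simp

/-- The functional `λ + R*_λ(η)` lies in the two-sided orbit of `λ` under the full unitriangular
group. -/
theorem exists_act_eq_add_frakR [Finite F] {P : TriPoset n} {lam : NilDual F P}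
    (hlam : IsSetPartition lam) (eta : NilDual F P) :
    ∃ p ∈ patternGroup F (TriPoset.full n), ∃ q ∈ patternGroup F (TriPoset.full n),
      ∀ j k, (j, k) ∈ P.rel → coord (lam + frakR lam eta) j k = act p q (mat lam) j k := by
  classical
  set E' := mat (restrictTo eta (coauxL lam)) with hE'
  set E'' := mat (restrictTo eta (coauxR lam \ coauxL lam)) with hE''
  have h' : ∀ j k, E' j k ≠ 0 → (j, k) ∈ coauxL lam := by
    intro j k h
    by_contra h0
    rw [hE', mat_apply, coord_restrictTo, if_neg h0] at h
    exact h rfl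
  have h'' : ∀ j k, E'' j k ≠ 0 → (j, k) ∈ coauxR lam := by
    intro j k h
    by_contra h0
    rw [hE'', mat_apply, coord_restrictTo, if_neg fun h1 => h0 h1.1] at h
    exact h rfl
  -- A position of `coauxL` lies below the support entry of its column, so `E' * matInv lam` is
  -- strictly lower triangular and its transpose is admissible for `p`.
  have hlt' : ∀ j l i, E' j l * (coord lam i l)⁻¹ ≠ 0 → i < j ∧ (i, l) ∈ supp lam := by
    intro j l i h
    obtain ⟨-, ⟨i', hi', hs⟩, -⟩ := mem_coauxL_iff.1 (h' j l (left_ne_zero_of_mul h))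
    have hs' : (i, l) ∈ supp lam := mem_supp.2 (fun h0 => right_ne_zero_of_mul h (by rw [h0, inv_zero]))
    exact ⟨hlam.2 _ _ _ hs' hs ▸ hi', hs'⟩
  have hlt'' : ∀ i k l, (coord lam i l)⁻¹ * E'' i k ≠ 0 → k < l := by
    intro i k l h
    obtain ⟨-, ⟨l', hl', hs⟩, -⟩ := mem_coauxR_iff.1 (h'' i k (right_ne_zero_of_mul h))
    have hs' : (i, l) ∈ supp lam := mem_supp.2 (fun h0 => left_ne_zero_of_mul h (by rw [h0, inv_zero]))
    rw [hlam.1 _ _ _ hs' hs]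
    exact hl'
  have hp : IsPattern (TriPoset.full n) (1 + (E' * matInv lam).transpose) := by
    rw [isPattern_iff, add_sub_cancel_left]
    intro i j hij
    rw [Matrix.transpose_apply, Matrix.mul_apply]
    refine Finset.sum_eq_zero fun l _ => ?_
    by_contra h
    exact hij (hlt' j l i h).1
  have hq : IsPattern (TriPoset.full n) (1 + (matInv lam * E'').transpose) := by
    rw [isPattern_iff, add_sub_cancel_left]
    intro k l hkl
    rw [Matrix.transpose_apply, Matrix.mul_apply]
    refine Finset.sum_eq_zero fun i _ => ?_
    by_contra h
    exact hkl (hlt'' i k l h)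
  obtain ⟨p, hp1, hp2⟩ := exists_patternGroup hp
  obtain ⟨q, hq1, hq2⟩ := exists_patternGroup hq
  refine ⟨p, hp1, q, hq1, fun j k hjk => ?_⟩
  have e1 : E' * (matInv lam * mat lam) = E' := mul_matInv_mul_mat hlam fun j k h => by
    obtain ⟨-, ⟨i, -, hi⟩, -⟩ := mem_coauxL_iff.1 (h' j k h)
    exact ⟨i, hi⟩
  have e2 : (mat lam * matInv lam) * E'' = E'' := mat_mul_matInv_mul hlam fun j k h => by
    obtain ⟨-, ⟨i, -, hi⟩, -⟩ := mem_coauxR_iff.1 (h'' j k h)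
    exact ⟨i, hi⟩
  -- With `D = matInv lam`, expand `(1 + E' D) λ (1 + D E'')`. The projections `D λ` and `λ D` are
  -- absorbed by `E'` and `E''`, and the cross term `E' D E''` is the quadratic sum of the star
  -- product.
  have e3 : act p q (mat lam) = mat lam + (E' + E'' + E' * (matInv lam * E'')) := by
    rw [act, hp2, hq2]
    simp only [Matrix.transpose_add, Matrix.transpose_one, Matrix.transpose_transpose]
    calc (1 + E' * matInv lam) * mat lam * (1 + matInv lam * E'')
        = mat lam + (E' * (matInv lam * mat lam) + (mat lam * matInv lam) * E'' +
            (E' * (matInv lam * mat lam)) * (matInv lam * E'')) := by noncomm_ring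
      _ = _ := by rw [e1, e2]
  have e4 : (E' * (matInv lam * E'')) j k = ∑ p : Fin n × Fin n,
      if p.1 < j ∧ j < k ∧ k < p.2 ∧ p ∈ supp lam then
        E' j p.2 * E'' p.1 k * (coord lam p.1 p.2)⁻¹ else 0 := by
    rw [Fintype.sum_prod_type, Finset.sum_comm, Matrix.mul_apply]
    refine Finset.sum_congr rfl fun l _ => ?_
    rw [Matrix.mul_apply, Finset.mul_sum]
    refine Finset.sum_congr rfl fun i _ => ?_
    simp only [matInv, Matrix.of_apply]
    split_ifs with h
    · ring
    · by_contra h0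
      have a1 : E' j l * (coord lam i l)⁻¹ ≠ 0 := fun h1 => h0 (by rw [← mul_assoc, h1, zero_mul])
      have a2 : (coord lam i l)⁻¹ * E'' i k ≠ 0 := fun h1 => h0 (by rw [h1, mul_zero])
      exact h ⟨(hlt' _ _ _ a1).1, P.lt_of_mem _ _ hjk, hlt'' _ _ _ a2, (hlt' _ _ _ a1).2⟩
  rw [e3, coord_add, Matrix.add_apply, mat_apply, Matrix.add_apply, Matrix.add_apply, e4, frakR,
    coord_starProd _ _ _ hjk]
  rfl

/-- Moving a set partition by a pair in the pattern group cannot change only an entry outside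
`coadj`. -/
theorem act_apply_eq_of_row_eq [Finite F] {P : TriPoset n} (hP : P.IsNormal)
    {M : Matrix (Fin n) (Fin n) F} {j k : Fin n}
    (hL : ∀ i, (i, j) ∈ P.rel → M i k = 0) (hR : ∀ l, (k, l) ∈ P.rel → M j l = 0)
    {a b : GL (Fin n) F} (ha : a ∈ patternGroup F P) (hb : b ∈ patternGroup F P)
    (hrow : ∀ l, (k, l) ∈ P.rel → act a b M j l = M j l) : act a b M j k = M j k := by
  -- Undoing `b` mixes row `j` only towards the right, where the moved matrix agrees with `M` and
  -- hence vanishes. So `a` alone already leaves zeros there, and putting `b` back adds nothing to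
  -- the entry at `(j, k)`.
  have hz : ∀ l, (k, l) ∈ P.rel → act a 1 M j l = 0 := by
    intro l hl
    have e : act a 1 M = act 1 b⁻¹ (act a b M) := by simp [act_act]
    rw [e, act_apply, Finset.sum_eq_single j]
    · refine Finset.sum_eq_zero fun m _ => ?_
      by_cases hm : l ≤ m
      · have := hP.mem hl le_rfl hm
        rw [hrow m this, hR m this, mul_zero, zero_mul]
      · rw [((patternGroup F P).inv_mem hb).2.1 l m (not_le.1 hm), mul_zero]
    · intro i _ hi
      simp [hi]
    · simp
  have e : act a b M = act 1 b (act a 1 M) := by simp [act_act]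
  rw [e, act_apply, Finset.sum_eq_single j, Finset.sum_eq_single k, hb.1 k, act_apply,
    Finset.sum_eq_single j, Finset.sum_eq_single k, ha.1 j]
  · simp
  · intro l _ hl
    simp [hl.symm]
  · simp
  · intro i _ hi
    by_cases hij : (i, j) ∈ P.rel
    · refine Finset.sum_eq_zero fun l _ => ?_
      by_cases hlk : l = k
      · rw [hlk, hL i hij, mul_zero, zero_mul]
      · simp [Ne.symm hlk]
    · simp [pattern_eq_zero ha hi hij]
  · simp
  · intro l _ hl
    by_cases hkl : (k, l) ∈ P.rel
    · rw [hz l hkl, mul_zero, zero_mul]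
    · rw [pattern_eq_zero hb hl.symm hkl, mul_zero]
  · simp
  · intro i _ hi
    simp [hi]
  · simp

/-! ### Dependence on the entries to the upper right -/

/-- Two functionals agree strictly to the upper right of a position. -/
def AgreeNE {P : TriPoset n} (lam mu : NilDual F P) (j k : Fin n) : Prop :=
  ∀ i l, i ≤ j → k ≤ l → (i, l) ≠ (j, k) → coord lam i l = coord mu i l

theorem AgreeNE.mem_supp_iff {P : TriPoset n} {lam mu : NilDual F P} {j k : Fin n}
    (h : AgreeNE lam mu j k) {i l : Fin n} (hi : i ≤ j) (hl : k ≤ l) (hne : (i, l) ≠ (j, k)) :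
    (i, l) ∈ supp lam ↔ (i, l) ∈ supp mu := by
  rw [mem_supp, mem_supp, h i l hi hl hne]

theorem AgreeNE.mono {P : TriPoset n} {lam mu : NilDual F P} {j k i l : Fin n}
    (h : AgreeNE lam mu j k) (hi : i ≤ j) (hl : k ≤ l) : AgreeNE lam mu i l := by
  intro a b ha hb hne
  refine h a b (ha.trans hi) (hl.trans hb) fun h' => hne ?_
  rw [Prod.mk.injEq] at h' ⊢
  obtain ⟨rfl, rfl⟩ := h'
  exact ⟨le_antisymm ha hi, le_antisymm hl hb⟩

theorem AgreeNE.symm {P : TriPoset n} {lam mu : NilDual F P} {j k : Fin n}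
    (h : AgreeNE lam mu j k) : AgreeNE mu lam j k :=
  fun i l hi hl hne => (h i l hi hl hne).symm

/-- Membership of a position in `coauxL`, and likewise in `coauxR` and `coaux`, consults `λ` only
higher in the same column or further right in the same row. This permits induction from the upper
right corner. -/
theorem AgreeNE.mem_coauxL {P : TriPoset n} {lam mu : NilDual F P} {j k : Fin n}
    (h : AgreeNE lam mu j k) (hm : (j, k) ∈ coauxL lam) : (j, k) ∈ coauxL mu := by
  rw [mem_coauxL_iff] at *
  obtain ⟨h1, ⟨i, hi, hs⟩, h2⟩ := hm
  refine ⟨h1, ⟨i, hi, (h.mem_supp_iff hi.le le_rfl (by simp [hi.ne])).1 hs⟩, fun i hs hij => ?_⟩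
  have hi := P.lt_of_mem _ _ hij
  exact h2 i ((h.mem_supp_iff hi.le le_rfl (by simp [hi.ne])).2 hs) hij

theorem AgreeNE.mem_coauxR {P : TriPoset n} {lam mu : NilDual F P} {j k : Fin n}
    (h : AgreeNE lam mu j k) (hm : (j, k) ∈ coauxR lam) : (j, k) ∈ coauxR mu := by
  rw [mem_coauxR_iff] at *
  obtain ⟨h1, ⟨i, hi, hs⟩, h2⟩ := hm
  refine ⟨h1, ⟨i, hi, (h.mem_supp_iff le_rfl hi.le (by simp [hi.ne'])).1 hs⟩, fun i hs hij => ?_⟩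
  have hi := P.lt_of_mem _ _ hij
  exact h2 i ((h.mem_supp_iff le_rfl hi.le (by simp [hi.ne'])).2 hs) hij

theorem AgreeNE.mem_coaux {P : TriPoset n} {lam mu : NilDual F P} {j k : Fin n}
    (h : AgreeNE lam mu j k) (hm : (j, k) ∈ coaux lam) : (j, k) ∈ coaux mu := by
  rw [mem_coaux_iff] at *
  obtain ⟨h1, h2, h3, h4⟩ := hm
  refine ⟨h1, h2.imp ?_ ?_, fun i hs hij => ?_, fun i hs hij => ?_⟩
  · rintro ⟨i, hi, hs⟩
    exact ⟨i, hi, (h.mem_supp_iff hi.le le_rfl (by simp [hi.ne])).1 hs⟩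
  · rintro ⟨i, hi, hs⟩
    exact ⟨i, hi, (h.mem_supp_iff le_rfl hi.le (by simp [hi.ne'])).1 hs⟩
  · have hi := P.lt_of_mem _ _ hij
    exact h3 i ((h.mem_supp_iff hi.le le_rfl (by simp [hi.ne])).2 hs) hij
  · have hi := P.lt_of_mem _ _ hij
    exact h4 i ((h.mem_supp_iff le_rfl hi.le (by simp [hi.ne'])).2 hs) hij

theorem AgreeNE.coord_restrictTo {P : TriPoset n} {eta zeta : NilDual F P} {j k i l : Fin n}
    (h : AgreeNE eta zeta j k) (hi : i ≤ j) (hl : k ≤ l) (hne : (i, l) ≠ (j, k))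
    {S T : Set (Fin n × Fin n)} (hST : (i, l) ∈ S ↔ (i, l) ∈ T) :
    coord (restrictTo eta S) i l = coord (restrictTo zeta T) i l := by
  classical
  rw [PatternGroup.coord_restrictTo, PatternGroup.coord_restrictTo, h i l hi hl hne]
  simp only [hST]

open Classical in
/-- Up to the contribution of `η` at the position itself, an entry of `R*_λ(η)` depends only on
the entries strictly to its upper right. -/
theorem coord_frakR_sub {P : TriPoset n} {lam mu eta zeta : NilDual F P} {j k : Fin n}
    (h : AgreeNE lam mu j k) (h' : AgreeNE eta zeta j k) (hjk : (j, k) ∈ P.rel) :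
    coord (frakR lam eta) j k -
        (if (j, k) ∈ coauxL lam ∪ coauxR lam then coord eta j k else 0) =
      coord (frakR mu zeta) j k -
        (if (j, k) ∈ coauxL lam ∪ coauxR lam then coord zeta j k else 0) := by
  have hL : ∀ i l, i ≤ j → k ≤ l → ((i, l) ∈ coauxL lam ↔ (i, l) ∈ coauxL mu) :=
    fun i l hi hl => ⟨(h.mono hi hl).mem_coauxL, (h.mono hi hl).symm.mem_coauxL⟩
  have hR : ∀ i l, i ≤ j → k ≤ l → ((i, l) ∈ coauxR lam ↔ (i, l) ∈ coauxR mu) :=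
    fun i l hi hl => ⟨(h.mono hi hl).mem_coauxR, (h.mono hi hl).symm.mem_coauxR⟩
  -- The quadratic terms use `η` at `(j, l)` and `(i, k)` and `λ` at `(i, l)` with `i < j` and `k <
  -- l`, all strictly to the upper right.
  have hsum : (∑ p : Fin n × Fin n, if p.1 < j ∧ j < k ∧ k < p.2 ∧ p ∈ supp lam then
        coord (restrictTo eta (coauxL lam)) j p.2 *
          coord (restrictTo eta (coauxR lam \ coauxL lam)) p.1 k * (coord lam p.1 p.2)⁻¹ else 0) =
      ∑ p : Fin n × Fin n, if p.1 < j ∧ j < k ∧ k < p.2 ∧ p ∈ supp mu then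
        coord (restrictTo zeta (coauxL mu)) j p.2 *
          coord (restrictTo zeta (coauxR mu \ coauxL mu)) p.1 k * (coord mu p.1 p.2)⁻¹ else 0 := by
    refine Finset.sum_congr rfl ?_
    rintro ⟨i, l⟩ -
    by_cases h0 : i < j ∧ j < k ∧ k < l
    · obtain ⟨h1, h2, h3⟩ := h0
      have e1 := h'.coord_restrictTo le_rfl h3.le (by simp [h3.ne']) (hL j l le_rfl h3.le)
      have e2 := h'.coord_restrictTo h1.le le_rfl (by simp [h1.ne])
        (S := coauxR lam \ coauxL lam) (T := coauxR mu \ coauxL mu)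
        (and_congr (hR i k h1.le le_rfl) (not_congr (hL i k h1.le le_rfl)))
      simp only [h.mem_supp_iff h1.le h3.le (by simp [h1.ne]), e1, e2,
        h i l h1.le h3.le (by simp [h1.ne])]
    · rw [if_neg fun h1 => h0 ⟨h1.1, h1.2.1, h1.2.2.1⟩,
        if_neg fun h1 => h0 ⟨h1.1, h1.2.1, h1.2.2.1⟩]
  rw [frakR, frakR, coord_starProd _ _ _ hjk, coord_starProd _ _ _ hjk, hsum,
    coord_restrictTo, coord_restrictTo, coord_restrictTo, coord_restrictTo]
  simp only [Set.mem_sdiff, Set.mem_union, ← hL j k le_rfl le_rfl, ← hR j k le_rfl le_rfl]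
  by_cases hl : (j, k) ∈ coauxL lam <;> by_cases hr : (j, k) ∈ coauxR lam <;> simp [hl, hr]

end Normal

/-! ### Uniqueness of the pair in an orbit -/

section Classification

variable {F : Type*} [Field F] {n : ℕ}

theorem dual_ext_of_agreeNE {P : TriPoset n} {lam mu : NilDual F P}
    (h : ∀ j k, (j, k) ∈ P.rel → AgreeNE lam mu j k → coord lam j k = coord mu j k) :
    lam = mu := by
  -- The measure `j + (n - k)` drops strictly on moving to the upper right.
  have key : ∀ m : ℕ, ∀ j k : Fin n, (j : ℕ) + (n - k) = m → coord lam j k = coord mu j k := by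
    intro m
    induction m using Nat.strong_induction_on with
    | _ m ih =>
      intro j k hm
      by_cases hjk : (j, k) ∈ P.rel
      · refine h j k hjk fun i l hi hl hne => ih _ ?_ i l rfl
        have h1 : (i : ℕ) ≤ j := hi
        have h2 : (k : ℕ) ≤ l := hl
        have h3 : ¬ ((i : ℕ) = j ∧ (l : ℕ) = k) := fun h' =>
          hne (Prod.ext (Fin.ext h'.1) (Fin.ext h'.2))
        have := l.2
        omega
      · rw [coord_of_notMem _ hjk, coord_of_notMem _ hjk]
  exact dual_ext fun j k _ => key _ j k rfl

/-- The functional with a single coordinate. -/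
noncomputable def dualSingle {P : TriPoset n} (j k : Fin n) (c : F) : NilDual F P :=
  ofMatrix fun i l => Matrix.single j k c i l

theorem coord_dualSingle {P : TriPoset n} {j k : Fin n} (h : (j, k) ∈ P.rel) (c : F)
    (i l : Fin n) :
    coord (dualSingle j k c : NilDual F P) i l = Matrix.single j k c i l := by
  by_cases hil : (i, l) ∈ P.rel
  · rw [dualSingle, coord_ofMatrix _ hil]
  · rw [coord_of_notMem _ hil, Matrix.single_apply_of_ne]
    rintro ⟨rfl, rfl⟩
    exact hil h

theorem single_apply_of_pair_ne {j k i l : Fin n} (h : (i, l) ≠ (j, k)) (c : F) :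
    Matrix.single j k c i l = 0 := by
  rw [Matrix.single_apply_of_ne]
  rintro ⟨rfl, rfl⟩
  exact h rfl

/-- The hypotheses say that `(i, l)` does not come after `(j, k)` in reading order, so the altered
position is never strictly to the upper right of `(i, l)`. -/
theorem agreeNE_add_dualSingle {P : TriPoset n} {j k : Fin n} (h : (j, k) ∈ P.rel) (c : F)
    (lam : NilDual F P) {i l : Fin n} (hne : i ≤ j) (hne' : (i, l) ≠ (j, k) → i < j ∨ k < l) :
    AgreeNE (lam + dualSingle j k c) lam i l := by
  intro a b ha hb hab
  rw [coord_add, coord_dualSingle h, single_apply_of_pair_ne, add_zero]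
  rintro hab'
  rw [Prod.mk.injEq] at hab'
  obtain ⟨rfl, rfl⟩ := hab'
  have e : i = a := le_antisymm hne ha
  subst e
  have : (i, l) ≠ (i, b) := fun h' => hab h'.symm
  rcases hne' this with h' | h'
  · exact lt_irrefl _ h'
  · exact absurd hb (not_le.2 h')

theorem supp_zero {P : TriPoset n} : supp (0 : NilDual F P) = ∅ := by
  ext ⟨i, j⟩
  rw [mem_supp]
  unfold coord
  simp

variable [Finite F]

/-- By normality every entry that influences a position of `P` is itself at a position of `P`;
values elsewhere are irrelevant. -/
theorem act_congr_rel {P : TriPoset n} (hP : P.IsNormal) {a b : GL (Fin n) F}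
    (ha : a ∈ patternGroup F (TriPoset.full n)) (hb : b ∈ patternGroup F (TriPoset.full n))
    {M N : Matrix (Fin n) (Fin n) F} (h : ∀ j k, (j, k) ∈ P.rel → M j k = N j k)
    {j k : Fin n} (hjk : (j, k) ∈ P.rel) : act a b M j k = act a b N j k :=
  act_congr ha hb fun i l hi hl => h i l (hP.mem hjk hi hl)

/-- Set partitions in the same orbit of the full unitriangular group are equal. -/
theorem eq_of_full_orbit {P : TriPoset n} (hP : P.IsNormal) {lam mu : NilDual F P}
    (hlam : IsSetPartition lam) (hmu : IsSetPartition mu) {x y : GL (Fin n) F}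
    (hx : x ∈ patternGroup F (TriPoset.full n)) (hy : y ∈ patternGroup F (TriPoset.full n))
    (h : ∀ j k, (j, k) ∈ P.rel → coord mu j k = act x y (mat lam) j k) : lam = mu := by
  refine dual_ext_of_agreeNE fun j k hjk hag => ?_
  by_cases hL : ∃ i < j, (i, k) ∈ supp lam
  · obtain ⟨i, hi, hs⟩ := hL
    have hs' := (hag.mem_supp_iff hi.le le_rfl (by simp [hi.ne])).1 hs
    have e1 : coord lam j k = 0 := by
      by_contra h0
      exact hi.ne (hlam.2 _ _ _ hs (mem_supp.2 h0))
    have e2 : coord mu j k = 0 := by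
      by_contra h0
      exact hi.ne (hmu.2 _ _ _ hs' (mem_supp.2 h0))
    rw [e1, e2]
  by_cases hR : ∃ l, k < l ∧ (j, l) ∈ supp lam
  · obtain ⟨i, hi, hs⟩ := hR
    have hs' := (hag.mem_supp_iff le_rfl hi.le (by simp [hi.ne'])).1 hs
    have e1 : coord lam j k = 0 := by
      by_contra h0
      exact hi.ne' (hlam.1 _ _ _ hs (mem_supp.2 h0))
    have e2 : coord mu j k = 0 := by
      by_contra h0
      exact hi.ne' (hmu.1 _ _ _ hs' (mem_supp.2 h0))
    rw [e1, e2]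
  -- With no support entry above `(j, k)` or to its right, the position is outside `coadj` for the
  -- full poset, so even the full group cannot change it.
  have := act_apply_eq_of_row_eq TriPoset.isNormal_full (M := mat lam) (j := j) (k := k)
    (fun i hi => by
      by_contra h0
      exact hL ⟨i, hi, mem_supp.2 h0⟩)
    (fun l hl => by
      by_contra h0
      exact hR ⟨l, hl, mem_supp.2 h0⟩) hx hy (fun l hl => by
      have hl' : k < l := hl
      rw [← h j l (hP.mem hjk le_rfl hl'.le), mat_apply, hag j l le_rfl hl'.le (by simp [hl'.ne'])])
  rw [h j k hjk, this, mat_apply]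

/-- The pair `(λ, η)` is determined by the orbit of `λ + R*_λ(η)`. -/
theorem pair_unique {P : TriPoset n} (hP : P.IsNormal) {lam eta mu zeta : NilDual F P}
    (hlam : IsSetPartition lam) (hmu : IsSetPartition mu) (heta : supp eta ⊆ coaux lam)
    (hzeta : supp zeta ⊆ coaux mu)
    (h : mu + frakR mu zeta ∈ twoSidedOrbit (lam + frakR lam eta)) : lam = mu ∧ eta = zeta := by
  obtain ⟨a, ha, b, hb, hab⟩ := mem_twoSidedOrbit.1 h
  obtain ⟨p, hp, q, hq, hpq⟩ := exists_act_eq_add_frakR hlam eta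
  obtain ⟨p', hp', q', hq', hpq'⟩ := exists_act_eq_add_frakR hmu zeta
  have ha' := patternGroup_le_full P ha
  have hb' := patternGroup_le_full P hb
  set U := patternGroup F (TriPoset.full n)
  have hab2 : ∀ j k, (j, k) ∈ P.rel →
      coord (mu + frakR mu zeta) j k = act a b (act p q (mat lam)) j k := by
    intro j k hjk
    rw [hab j k hjk]
    exact act_congr_rel hP ha' hb' hpq hjk
  -- Absorbing `p`, `q`, `p'`, `q'` puts `λ` and `μ` in a single orbit of the full group.
  have hlm : lam = mu := by
    refine eq_of_full_orbit hP hlam hmu (x := p * a * p'⁻¹) (y := q'⁻¹ * (b * q))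
      (U.mul_mem (U.mul_mem hp ha') (U.inv_mem hp'))
      (U.mul_mem (U.inv_mem hq') (U.mul_mem hb' hq)) fun j k hjk => ?_
    have e1 : act p'⁻¹ q'⁻¹ (act p' q' (mat mu)) = mat mu := by simp [act_act]
    rw [← mat_apply, ← e1, ← act_act, ← act_act]
    refine act_congr_rel hP (U.inv_mem hp') (U.inv_mem hq') (fun i l hil => ?_) hjk
    rw [← hpq' i l hil, hab2 i l hil]
  refine ⟨hlm, ?_⟩
  subst hlm
  refine dual_ext_of_agreeNE fun j k hjk hag => ?_
  by_cases hc : (j, k) ∈ coaux lam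
  · obtain ⟨-, -, hL, hR⟩ := mem_coaux_iff.1 hc
    have hc' := coaux_subset_union hc
    have hrefl : ∀ j k, AgreeNE lam lam j k := fun j k i l _ _ _ => rfl
    set s := coord zeta j k - coord eta j k with hs
    set V := mat (lam + frakR lam eta) with hV
    set V' := mat (lam + frakR lam zeta) with hV'
    -- As `η` and `ζ` agree strictly to the upper right, the two translates differ there only at
    -- `(j, k)`, by `s`.
    have hVV' : ∀ i l, i ≤ j → k ≤ l → V' i l = (V + Matrix.single j k s) i l := by
      intro i l hi hl
      have hil := hP.mem hjk hi hl
      have := coord_frakR_sub (hrefl i l) (hag.mono hi hl) hil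
      rw [Matrix.add_apply, hV, hV', mat_apply, mat_apply, coord_add, coord_add]
      by_cases hne : (i, l) = (j, k)
      · obtain ⟨rfl, rfl⟩ := Prod.mk.inj hne
        rw [if_pos hc', if_pos hc'] at this
        rw [Matrix.single_apply_same, hs]
        linear_combination -this
      · rw [hag i l hi hl hne] at this
        rw [single_apply_of_pair_ne hne]
        linear_combination -this
    have hx := conj_mem_patternGroup hP hp ha
    have hy := conj_mem_patternGroup' hP hq hb
    have e1 : ∀ i l, i ≤ j → k ≤ l → act (p * a * p⁻¹) (q⁻¹ * b * q) (mat lam) i l =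
        coord lam i l + act p⁻¹ q⁻¹ (Matrix.single j k s) i l := by
      intro i l hi hl
      have e2 : act p⁻¹ q⁻¹ (act p q (mat lam)) = mat lam := by simp [act_act]
      rw [mul_assoc q⁻¹, ← act_act, ← act_act, ← mat_apply lam i l]
      conv_rhs => rw [← e2]
      rw [← Matrix.add_apply, ← act_add]
      refine act_congr (U.inv_mem hp) (U.inv_mem hq) fun i' l' hi' hl' => ?_
      have hil := hP.mem hjk (hi'.trans hi) (hl.trans hl')
      rw [← hab2 i' l' hil, Matrix.add_apply, ← hpq i' l' hil]
      exact hVV' i' l' (hi'.trans hi) (hl.trans hl')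
    -- Conjugated back to `λ`, the pair from `U_P` would add `s` to an entry outside `coadj P`,
    -- which forces `s = 0`.
    have e3 := act_apply_eq_of_row_eq hP (M := mat lam) (j := j) (k := k)
      (fun i hi => by
        by_contra h0
        exact hL i (mem_supp.2 h0) hi)
      (fun l hl => by
        by_contra h0
        exact hR l (mem_supp.2 h0) hl) hx hy (fun l hl => by
        have hl' := P.lt_of_mem _ _ hl
        rw [e1 j l le_rfl hl'.le, act_apply_of_vanish (U.inv_mem hp) (U.inv_mem hq),
          single_apply_of_pair_ne (by simp [hl'.ne']), add_zero, mat_apply]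
        intro i' l'' hi' hl'' _
        exact single_apply_of_pair_ne (by simp [(hl'.trans_le hl'').ne']) s)
    rw [e1 j k le_rfl le_rfl, act_apply_of_vanish (U.inv_mem hp) (U.inv_mem hq)
      (fun i l _ _ hne => single_apply_of_pair_ne hne s), Matrix.single_apply_same, mat_apply,
      add_eq_left, hs, sub_eq_zero] at e3
    exact e3.symm
  · have e1 : coord eta j k = 0 := by
      by_contra h0
      exact hc (heta (mem_supp.2 h0))
    have e2 : coord zeta j k = 0 := by
      by_contra h0
      exact hc (hzeta (mem_supp.2 h0))
    rw [e1, e2]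

/-! ### Existence of the pair, by filling positions in reading order -/

/-- The rank of a position when the positions are read row by row, each from right to left. -/
def readingRank (j k : Fin n) : ℕ := j * n + (n - 1 - k)

theorem readingRank_lt_of_row_lt {i j : Fin n} (k l : Fin n) (h : i < j) :
    readingRank i l < readingRank j k := by
  have h1 : ((i : ℕ) + 1) * n ≤ j * n := Nat.mul_le_mul_right _ h
  have := l.2
  rw [add_mul] at h1
  unfold readingRank
  omega

theorem readingRank_lt_iff {i j k l : Fin n} :
    readingRank i l < readingRank j k ↔ i < j ∨ i = j ∧ k < l := by
  constructor
  · intro h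
    rcases lt_trichotomy i j with h' | rfl | h'
    · exact Or.inl h'
    · refine Or.inr ⟨rfl, ?_⟩
      unfold readingRank at h
      have := k.2
      change (k : ℕ) < l
      omega
    · exact absurd h (lt_asymm (readingRank_lt_of_row_lt l k h'))
  · rintro (h | ⟨rfl, h⟩)
    · exact readingRank_lt_of_row_lt k l h
    · unfold readingRank
      have h' : (k : ℕ) < l := h
      have := l.2
      omega

theorem readingRank_lt_of_ne {i j k l : Fin n} (hi : i ≤ j) (hl : k ≤ l) (hne : (i, l) ≠ (j, k)) :
    readingRank i l < readingRank j k := by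
  rw [readingRank_lt_iff]
  rcases hi.lt_or_eq with h | rfl
  · exact Or.inl h
  · exact Or.inr ⟨rfl, lt_of_le_of_ne hl fun h => hne (by rw [h])⟩

theorem eq_of_readingRank_eq {i j k l : Fin n} (h : readingRank i l = readingRank j k) :
    (i, l) = (j, k) := by
  have h1 := (readingRank_lt_iff (i := i) (j := j) (k := k) (l := l)).not.1 h.not_lt
  have h2 := (readingRank_lt_iff (i := j) (j := i) (k := l) (l := k)).not.1 h.not_gt
  push Not at h1 h2
  have e : i = j := le_antisymm h2.1 h1.1
  exact Prod.ext e (le_antisymm (h1.2 e) (h2.2 e.symm))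

/-- Inside `coadj` one entry of the orbit can be corrected. -/
theorem exists_act_single {P : TriPoset n} {lam : NilDual F P} (hlam : IsSetPartition lam)
    {j k : Fin n} (s : F)
    (h : (∃ i, (i, k) ∈ supp lam ∧ (i, j) ∈ P.rel) ∨ ∃ l, (j, l) ∈ supp lam ∧ (k, l) ∈ P.rel) :
    ∃ x ∈ patternGroup F P, ∃ y ∈ patternGroup F P,
      act x y (mat lam) = mat lam + Matrix.single j k s := by
  rcases h with ⟨i, hs, hij⟩ | ⟨l, hs, hkl⟩
  -- This adds a multiple of row `i` to row `j`. Row `i` has a single nonzero entry, in column `k`,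
  -- so nothing else changes; the scalar makes the change equal to `s`.
  · obtain ⟨x, hx, hxe⟩ := exists_transvection hij (s * (coord lam i k)⁻¹)
    refine ⟨x, hx, 1, Subgroup.one_mem _, ?_⟩
    rw [act, hxe, Units.val_one, Matrix.transpose_one, mul_one, Matrix.transpose_add,
      Matrix.transpose_one, add_mul, one_mul]
    congr 1
    ext a b
    rw [Matrix.transpose_smul, Matrix.transpose_single, smul_mul_assoc, Matrix.smul_apply]
    by_cases ha : a = j
    · subst ha
      rw [Matrix.single_mul_apply_same, one_mul, mat_apply]
      by_cases hbk : b = k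
      · subst hbk
        rw [Matrix.single_apply_same, smul_eq_mul, mul_assoc,
          inv_mul_cancel₀ (mem_supp.1 hs), mul_one]
      · have : coord lam i b = 0 := by
          by_contra h0
          exact hbk (hlam.1 _ _ _ (mem_supp.2 h0) hs)
        rw [this, smul_zero, single_apply_of_pair_ne (by simp [hbk])]
    · rw [Matrix.single_mul_apply_of_ne _ _ _ _ _ ha, smul_zero,
        single_apply_of_pair_ne (by simp [ha])]
  · obtain ⟨y, hy, hye⟩ := exists_transvection hkl (s * (coord lam j l)⁻¹)
    refine ⟨1, Subgroup.one_mem _, y, hy, ?_⟩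
    rw [act, hye, Units.val_one, Matrix.transpose_one, one_mul, Matrix.transpose_add,
      Matrix.transpose_one, mul_add, mul_one]
    congr 1
    ext a b
    rw [Matrix.transpose_smul, Matrix.transpose_single, mul_smul_comm, Matrix.smul_apply]
    by_cases hb : b = k
    · subst hb
      rw [Matrix.mul_single_apply_same, mul_one, mat_apply]
      by_cases haj : a = j
      · subst haj
        rw [Matrix.single_apply_same, smul_eq_mul, mul_assoc,
          inv_mul_cancel₀ (mem_supp.1 hs), mul_one]
      · have : coord lam a l = 0 := by
          by_contra h0
          exact haj (hlam.2 _ _ _ (mem_supp.2 h0) hs)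
        rw [this, smul_zero, single_apply_of_pair_ne (by simp [haj])]
    · rw [Matrix.mul_single_apply_of_ne _ _ _ _ _ hb, smul_zero,
        single_apply_of_pair_ne (by simp [hb])]

/-- Agreement with `λ + R*_λ(η)` on the positions of small reading rank. -/
theorem exists_pair_agree {P : TriPoset n} (hP : P.IsNormal) (mu : NilDual F P) (m : ℕ) :
    ∃ lam eta : NilDual F P, IsSetPartition lam ∧ supp eta ⊆ coaux lam ∧
      (∀ i l, (i, l) ∈ supp lam → readingRank i l < m) ∧
      (∀ i l, (i, l) ∈ supp eta → readingRank i l < m) ∧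
      ∃ a ∈ patternGroup F P, ∃ b ∈ patternGroup F P, ∀ i l, (i, l) ∈ P.rel →
        readingRank i l < m → act a b (mat mu) i l = coord (lam + frakR lam eta) i l := by
  induction m with
  | zero =>
    refine ⟨0, 0, ?_, ?_, ?_, ?_, 1, Subgroup.one_mem _, 1, Subgroup.one_mem _, ?_⟩
    · constructor <;> simp [supp_zero]
    all_goals simp [supp_zero]
  | succ m ih =>
    obtain ⟨lam, eta, hlam, heta, hlm, hem, a, ha, b, hb, hab⟩ := ih
    by_cases hex : ∃ j k : Fin n, (j, k) ∈ P.rel ∧ readingRank j k = m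
    swap
    · refine ⟨lam, eta, hlam, heta, fun i l h => (hlm i l h).trans m.lt_succ_self,
        fun i l h => (hem i l h).trans m.lt_succ_self, a, ha, b, hb, fun i l hil hm => ?_⟩
      refine hab i l hil ((Nat.lt_succ_iff.1 hm).lt_of_ne fun h => hex ⟨i, l, hil, h⟩)
    obtain ⟨j, k, hjk, hm⟩ := hex
    have hcase : ∀ i l, readingRank i l < m + 1 → (i, l) ≠ (j, k) → readingRank i l < m :=
      fun i l h hne => (Nat.lt_succ_iff.1 h).lt_of_ne fun h' =>
        hne (eq_of_readingRank_eq (h'.trans hm.symm))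
    have hearly : ∀ i l, readingRank i l < m + 1 → i ≤ j ∧ ((i, l) ≠ (j, k) → i < j ∨ k < l) := by
      intro i l h
      by_cases hne : (i, l) = (j, k)
      · exact ⟨(Prod.mk.inj hne).1.le, fun h' => absurd hne h'⟩
      · have := hcase i l h hne
        rw [← hm, readingRank_lt_iff] at this
        rcases this with h' | ⟨rfl, h'⟩
        · exact ⟨h'.le, fun _ => Or.inl h'⟩
        · exact ⟨le_rfl, fun _ => Or.inr h'⟩
    have hne_add : ∀ (c : F) (nu : NilDual F P) i l, readingRank i l < m + 1 →
        AgreeNE (nu + dualSingle j k c) nu i l :=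
      fun c nu i l h => agreeNE_add_dualSingle hjk c nu (hearly i l h).1 (hearly i l h).2
    have hcoord_add : ∀ (c : F) (nu : NilDual F P) i l, (i, l) ≠ (j, k) →
        coord (nu + dualSingle j k c) i l = coord nu i l := by
      intro c nu i l hne
      rw [coord_add, coord_dualSingle hjk, single_apply_of_pair_ne hne, add_zero]
    have hcoord_self : ∀ (c : F) (nu : NilDual F P),
        coord (nu + dualSingle j k c) j k = coord nu j k + c := by
      intro c nu
      rw [coord_add, coord_dualSingle hjk, Matrix.single_apply_same]
    have hsupp_add : ∀ (c : F) (nu : NilDual F P),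
        (∀ i l, (i, l) ∈ supp nu → readingRank i l < m) →
        ∀ i l, (i, l) ∈ supp (nu + dualSingle j k c) → readingRank i l < m + 1 := by
      intro c nu hnu i l h
      by_cases hne : (i, l) = (j, k)
      · obtain ⟨rfl, rfl⟩ := Prod.mk.inj hne
        omega
      · rw [mem_supp, hcoord_add c nu i l hne, ← mem_supp] at h
        exact (hnu i l h).trans m.lt_succ_self
    have hrefl : ∀ (nu : NilDual F P) i l, AgreeNE nu nu i l := fun nu i l _ _ _ _ _ => rfl
    set W := act a b (mat mu) with hW
    by_cases hcP : (∃ i, (i, k) ∈ supp lam ∧ (i, j) ∈ P.rel) ∨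
        ∃ l, (j, l) ∈ supp lam ∧ (k, l) ∈ P.rel
    · obtain ⟨p, hp, q, hq, hpq⟩ := exists_act_eq_add_frakR hlam eta
      set V := mat (lam + frakR lam eta) with hV
      -- The correction is made on `λ` and transported by `p`, `q`. It touches only positions weakly
      -- to the lower left of `(j, k)`, so nothing read earlier is disturbed.
      obtain ⟨x, hx, y, hy, hxy⟩ := exists_act_single hlam (V j k - W j k) hcP
      have hx' := conj_mem_patternGroup' hP hp hx
      have hy' := conj_mem_patternGroup hP hq hy
      set U := patternGroup F (TriPoset.full n)
      refine ⟨lam, eta, hlam, heta, fun i l h => (hlm i l h).trans m.lt_succ_self,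
        fun i l h => (hem i l h).trans m.lt_succ_self, a * (p⁻¹ * x * p),
        Subgroup.mul_mem _ ha hx', q * y * q⁻¹ * b, Subgroup.mul_mem _ hy' hb,
        fun i l hil hr => ?_⟩
      rw [← act_act, ← hW]
      have hx'' := patternGroup_le_full P hx'
      have hy'' := patternGroup_le_full P hy'
      have eW : W = V + (W - V) := by abel
      have hWV : ∀ i l, (i, l) ∈ P.rel → readingRank i l < m → (W - V) i l = 0 := by
        intro i l hil hr
        rw [Matrix.sub_apply, hab i l hil hr, sub_eq_zero]
        rfl
      have hstrict : ∀ i' l', i' ≤ i → l ≤ l' → (i', l') ≠ (i, l) → readingRank i' l' < m :=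
        fun i' l' hi' hl' hne => by
          have := readingRank_lt_of_ne hi' hl' hne
          omega
      rw [eW, act_add, Matrix.add_apply, act_apply_of_vanish hx'' hy'' (Z := W - V)
        (fun i' l' hi' hl' hne => hWV i' l' (hP.mem hil hi' hl') (hstrict i' l' hi' hl' hne))]
      have e1 : act (p⁻¹ * x * p) (q * y * q⁻¹) V i l =
          act p q (mat lam + Matrix.single j k (V j k - W j k)) i l := by
        have e2 : act p q (act x y (mat lam)) =
            act (p⁻¹ * x * p) (q * y * q⁻¹) (act p q (mat lam)) := by
          simp only [act_act]
          congr 1 <;> group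
        rw [← hxy, e2]
        exact act_congr_rel hP hx'' hy'' hpq hil
      rw [e1, act_add, Matrix.add_apply, ← hpq i l hil, act_apply_of_vanish hp hq]
      · by_cases hne : (i, l) = (j, k)
        · obtain ⟨rfl, rfl⟩ := Prod.mk.inj hne
          rw [Matrix.single_apply_same, Matrix.sub_apply]
          ring
        · rw [single_apply_of_pair_ne hne, hWV i l hil (hcase i l hr hne), add_zero, add_zero]
      · intro i' l' hi' hl' hne
        refine single_apply_of_pair_ne (fun h => ?_) _
        obtain ⟨rfl, rfl⟩ := Prod.mk.inj h
        have := hstrict _ _ hi' hl' hne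
        omega
    push Not at hcP
    -- The discrepancy cannot be removed in this case: it becomes a coordinate of `η` at a position
    -- of `coaux`, and a new entry of `λ` otherwise.
    set c := W j k - coord (lam + frakR lam eta) j k with hc
    by_cases hcaux : (∃ i < j, (i, k) ∈ supp lam) ∨ ∃ l, k < l ∧ (j, l) ∈ supp lam
    · have hmem : (j, k) ∈ coaux lam := mem_coaux_iff.2 ⟨hjk, hcaux, hcP.1, hcP.2⟩
      refine ⟨lam, eta + dualSingle j k c, hlam, ?_, fun i l h => (hlm i l h).trans m.lt_succ_self,
        hsupp_add c eta hem, a, ha, b, hb, fun i l hil hr => ?_⟩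
      · rintro ⟨i, l⟩ h
        by_cases hne : (i, l) = (j, k)
        · rwa [hne]
        · rw [mem_supp, hcoord_add c eta i l hne, ← mem_supp] at h
          exact heta h
      · have := coord_frakR_sub (hrefl lam i l) (hne_add c eta i l hr) hil
        rw [coord_add]
        by_cases hne : (i, l) = (j, k)
        · obtain ⟨rfl, rfl⟩ := Prod.mk.inj hne
          rw [if_pos (coaux_subset_union hmem), if_pos (coaux_subset_union hmem),
            hcoord_self] at this
          rw [coord_add] at hc
          linear_combination -this - hc
        · rw [hcoord_add _ _ _ _ hne] at this
          refine (hab i l hil (hcase i l hr hne)).trans ?_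
          rw [coord_add]
          linear_combination -this
    · push Not at hcaux
      have hnot : (j, k) ∉ coauxL lam ∪ coauxR lam := by
        rw [Set.mem_union, mem_coauxL_iff, mem_coauxR_iff]
        rintro (⟨-, ⟨i, hi, hs⟩, -⟩ | ⟨-, ⟨i, hi, hs⟩, -⟩)
        · exact hcaux.1 i hi hs
        · exact hcaux.2 i hi hs
      have hsup : ∀ i l, (i, l) ∈ supp (lam + dualSingle j k c) →
          (i, l) = (j, k) ∨ ((i, l) ∈ supp lam ∧ (i, l) ≠ (j, k)) := by
        intro i l h
        by_cases hne : (i, l) = (j, k)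
        · exact Or.inl hne
        · rw [mem_supp, hcoord_add _ _ _ _ hne, ← mem_supp] at h
          exact Or.inr ⟨h, hne⟩
      -- Support entries so far have smaller rank, so one in row `j` would lie to the right of `k`,
      -- which is excluded here; the column is similar. Hence the new entry keeps `λ` a set
      -- partition.
      have hrow : ∀ l, (j, l) ∉ supp lam := by
        intro l hl
        have := hlm j l hl
        rw [← hm, readingRank_lt_iff] at this
        rcases this with h | ⟨-, h⟩
        · exact lt_irrefl _ h
        · exact hcaux.2 l h hl
      have hcol : ∀ i, (i, k) ∉ supp lam := by
        intro i hi
        have := hlm i k hi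
        rw [← hm, readingRank_lt_iff] at this
        rcases this with h | ⟨-, h⟩
        · exact hcaux.1 i h hi
        · exact lt_irrefl _ h
      refine ⟨lam + dualSingle j k c, eta, ⟨?_, ?_⟩, ?_, hsupp_add c lam hlm,
        fun i l h => (hem i l h).trans m.lt_succ_self, a, ha, b, hb, fun i l hil hr => ?_⟩
      · intro i l l' h h'
        rcases hsup _ _ h with h1 | ⟨h1, -⟩ <;> rcases hsup _ _ h' with h2 | ⟨h2, -⟩
        · rw [(Prod.mk.inj h1).2, (Prod.mk.inj h2).2]
        · rw [(Prod.mk.inj h1).1] at h2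
          exact absurd h2 (hrow _)
        · rw [(Prod.mk.inj h2).1] at h1
          exact absurd h1 (hrow _)
        · exact hlam.1 _ _ _ h1 h2
      · intro i i' l h h'
        rcases hsup _ _ h with h1 | ⟨h1, -⟩ <;> rcases hsup _ _ h' with h2 | ⟨h2, -⟩
        · rw [(Prod.mk.inj h1).1, (Prod.mk.inj h2).1]
        · rw [(Prod.mk.inj h1).2] at h2
          exact absurd h2 (hcol _)
        · rw [(Prod.mk.inj h2).2] at h1
          exact absurd h1 (hcol _)
        · exact hlam.2 _ _ _ h1 h2
      · rintro ⟨i, l⟩ h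
        exact (hne_add c lam i l ((hem i l h).trans m.lt_succ_self)).symm.mem_coaux (heta h)
      · have := coord_frakR_sub (hne_add c lam i l hr).symm (hrefl eta i l) hil
        have e : coord (frakR (lam + dualSingle j k c) eta) i l = coord (frakR lam eta) i l := by
          linear_combination -this
        rw [coord_add, e]
        by_cases hne : (i, l) = (j, k)
        · obtain ⟨rfl, rfl⟩ := Prod.mk.inj hne
          rw [hcoord_self, hc, coord_add]
          ring
        · rw [hcoord_add _ _ _ _ hne, ← coord_add]
          exact hab i l hil (hcase i l hr hne)

/-- Every two-sided orbit contains some `λ + R*_λ(η)`. -/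
theorem exists_pair_mem_orbit {P : TriPoset n} (hP : P.IsNormal) (mu : NilDual F P) :
    ∃ lam eta : NilDual F P, IsSetPartition lam ∧ supp eta ⊆ coaux lam ∧
      lam + frakR lam eta ∈ twoSidedOrbit mu := by
  obtain ⟨lam, eta, hlam, heta, -, -, a, ha, b, hb, hab⟩ := exists_pair_agree hP mu (n * n)
  refine ⟨lam, eta, hlam, heta, mem_twoSidedOrbit.2 ⟨a, ha, b, hb, fun j k hjk => ?_⟩⟩
  refine (hab j k hjk ?_).symm
  have h1 : ((j : ℕ) + 1) * n ≤ n * n := Nat.mul_le_mul_right _ j.2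
  have := k.2
  rw [add_mul] at h1
  unfold readingRank
  omega

end Classification

/-! ### Supercharacters, orbits and degrees -/

section Characters

variable {F : Type*} [Field F] {n : ℕ}

/-- The additive character `X ↦ θ(λ(X))`. -/
def dualChar (θ : AddChar F ℂ) {P : TriPoset n} (lam : NilDual F P) : AddChar (nil F P) ℂ :=
  θ.compAddMonoidHom lam.toAddMonoidHom

theorem dualChar_apply (θ : AddChar F ℂ) {P : TriPoset n} (lam : NilDual F P) (X : nil F P) :
    dualChar θ lam X = θ (lam X) := rfl

/-- If `λ` and `μ` differ at `X`, scaling `X` makes their difference take every value in the field,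
so equal characters would make `θ` trivial. -/
theorem dualChar_injective {θ : AddChar F ℂ} (hθ : θ ≠ 1) (P : TriPoset n) :
    Function.Injective (dualChar θ : NilDual F P → AddChar (nil F P) ℂ) := by
  intro lam mu h
  by_contra hne
  apply hθ
  have : ∃ X, lam X - mu X ≠ 0 := by
    by_contra! h'
    exact hne (LinearMap.ext fun X => sub_eq_zero.1 (h' X))
  obtain ⟨X, hX⟩ := this
  ext t
  have h1 := DFunLike.congr_fun h ((t * (lam X - mu X)⁻¹) • X)
  rw [dualChar_apply, dualChar_apply, LinearMap.map_smul lam, LinearMap.map_smul mu] at h1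
  have e : t = (t * (lam X - mu X)⁻¹) • lam X - (t * (lam X - mu X)⁻¹) • mu X := by
    rw [← smul_sub, smul_eq_mul, mul_assoc, inv_mul_cancel₀ hX, mul_one]
  rw [e, AddChar.map_sub_eq_div, h1, AddChar.one_apply, div_self]
  exact (AddChar.val_isUnit θ _).ne_zero

variable [Finite F]

instance finite_nilDual (P : TriPoset n) : Finite (NilDual F P) :=
  Finite.of_injective (fun lam : NilDual F P => fun p : Fin n × Fin n => coord lam p.1 p.2)
    fun _ _ h => dual_ext fun i j _ => congrFun h (i, j)

theorem subOne_surjective (P : TriPoset n) :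
    Function.Surjective (subOne : patternGroup F P → nil F P) := by
  intro X
  obtain ⟨a, ha, hae⟩ := exists_patternGroup (P := P)
    (g := 1 + (X : Matrix (Fin n) (Fin n) F)) (by
      rw [isPattern_iff, add_sub_cancel_left]
      exact X.2)
  refine ⟨⟨a, ha⟩, Subtype.ext ?_⟩
  change (a : Matrix (Fin n) (Fin n) F) - 1 = X
  rw [hae, add_sub_cancel_left]

theorem actL_mul {P : TriPoset n} (g h : patternGroup F P) (lam : NilDual F P) :
    actL (g * h) lam = actL g (actL h lam) := by
  apply LinearMap.ext
  intro X
  change lam (mulL (g * h)⁻¹ X) = lam (mulL h⁻¹ (mulL g⁻¹ X))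
  congr 1
  apply Subtype.ext
  change ((((g * h)⁻¹ : patternGroup F P) : GL (Fin n) F) : Matrix (Fin n) (Fin n) F) * X =
    (((h⁻¹ : patternGroup F P) : GL (Fin n) F) : Matrix (Fin n) (Fin n) F) *
      ((((g⁻¹ : patternGroup F P) : GL (Fin n) F) : Matrix (Fin n) (Fin n) F) * X)
  rw [mul_inv_rev, Subgroup.coe_mul, Units.val_mul, mul_assoc]

theorem actR_mul {P : TriPoset n} (g h : patternGroup F P) (lam : NilDual F P) :
    actR lam (g * h) = actR (actR lam g) h := by
  apply LinearMap.ext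
  intro X
  change lam (mulR (g * h)⁻¹ X) = lam (mulR g⁻¹ (mulR h⁻¹ X))
  congr 1
  apply Subtype.ext
  change (X : Matrix (Fin n) (Fin n) F) *
      ((((g * h)⁻¹ : patternGroup F P) : GL (Fin n) F) : Matrix (Fin n) (Fin n) F) =
    X * (((h⁻¹ : patternGroup F P) : GL (Fin n) F) : Matrix (Fin n) (Fin n) F) *
      (((g⁻¹ : patternGroup F P) : GL (Fin n) F) : Matrix (Fin n) (Fin n) F)
  rw [mul_inv_rev, Subgroup.coe_mul, Units.val_mul, mul_assoc]

theorem actL_actR {P : TriPoset n} (g h : patternGroup F P) (lam : NilDual F P) :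
    actL g (actR lam h) = actR (actL g lam) h := by
  apply LinearMap.ext
  intro X
  change lam (mulR h⁻¹ (mulL g⁻¹ X)) = lam (mulL g⁻¹ (mulR h⁻¹ X))
  congr 1
  apply Subtype.ext
  change (((g⁻¹ : patternGroup F P) : GL (Fin n) F) : Matrix (Fin n) (Fin n) F) * X *
      (((h⁻¹ : patternGroup F P) : GL (Fin n) F) : Matrix (Fin n) (Fin n) F) =
    (((g⁻¹ : patternGroup F P) : GL (Fin n) F) : Matrix (Fin n) (Fin n) F) * (X *
      (((h⁻¹ : patternGroup F P) : GL (Fin n) F) : Matrix (Fin n) (Fin n) F))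
  rw [mul_assoc]

@[simp] theorem actL_one {P : TriPoset n} (lam : NilDual F P) : actL 1 lam = lam := by
  apply LinearMap.ext
  intro X
  change lam (mulL 1⁻¹ X) = lam X
  congr 1
  apply Subtype.ext
  change (((1⁻¹ : patternGroup F P) : GL (Fin n) F) : Matrix (Fin n) (Fin n) F) * X = X
  simp

@[simp] theorem actR_one {P : TriPoset n} (lam : NilDual F P) : actR lam 1 = lam := by
  apply LinearMap.ext
  intro X
  change lam (mulR 1⁻¹ X) = lam X
  congr 1
  apply Subtype.ext
  change (X : Matrix (Fin n) (Fin n) F) *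
    (((1⁻¹ : patternGroup F P) : GL (Fin n) F) : Matrix (Fin n) (Fin n) F) = X
  simp

theorem self_mem_twoSidedOrbit {P : TriPoset n} (lam : NilDual F P) : lam ∈ twoSidedOrbit lam :=
  ⟨1, 1, by simp⟩

theorem self_mem_leftOrbit {P : TriPoset n} (lam : NilDual F P) : lam ∈ leftOrbit lam :=
  ⟨1, by simp⟩

theorem mem_twoSidedOrbit_symm {P : TriPoset n} {lam mu : NilDual F P}
    (h : mu ∈ twoSidedOrbit lam) : lam ∈ twoSidedOrbit mu := by
  obtain ⟨g, h, rfl⟩ := h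
  refine ⟨g⁻¹, h⁻¹, ?_⟩
  rw [actL_actR, ← actL_mul, ← actR_mul, inv_mul_cancel, mul_inv_cancel, actL_one, actR_one]

theorem mem_twoSidedOrbit_trans {P : TriPoset n} {lam mu nu : NilDual F P}
    (h : mu ∈ twoSidedOrbit lam) (h' : nu ∈ twoSidedOrbit mu) : nu ∈ twoSidedOrbit lam := by
  obtain ⟨g, h, rfl⟩ := h
  obtain ⟨g', h', rfl⟩ := h'
  exact ⟨g' * g, h * h', by rw [actL_actR, ← actL_mul, ← actR_mul]⟩

/-- The two-sided orbits coincide, and the left orbit of `g λ h` is that of `λ` translated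
bijectively by `h`. -/
theorem superchar_eq_of_mem_orbit (θ : AddChar F ℂ) {P : TriPoset n} {lam mu : NilDual F P}
    (h : mu ∈ twoSidedOrbit lam) : superchar θ mu = superchar θ lam := by
  have horb : twoSidedOrbit mu = twoSidedOrbit lam := Set.ext fun nu =>
    ⟨fun h' => mem_twoSidedOrbit_trans h h',
      fun h' => mem_twoSidedOrbit_trans (mem_twoSidedOrbit_symm h) h'⟩
  have hcard : (leftOrbit mu).ncard = (leftOrbit lam).ncard := by
    obtain ⟨g, h, rfl⟩ := h
    have hinj : Function.Injective fun nu : NilDual F P => actR nu h := by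
      intro nu nu' e
      have := congrArg (fun x => actR x h⁻¹) e
      simpa [← actR_mul] using this
    have himg : leftOrbit (actR (actL g lam) h) =
        (fun nu : NilDual F P => actR nu h) '' leftOrbit lam := by
      ext nu
      constructor
      · rintro ⟨g', rfl⟩
        exact ⟨actL (g' * g) lam, ⟨_, rfl⟩, by rw [actL_actR, ← actL_mul]⟩
      · rintro ⟨_, ⟨g', rfl⟩, rfl⟩
        refine ⟨g' * g⁻¹, ?_⟩
        rw [actL_actR, ← actL_mul, inv_mul_cancel_right]
    rw [himg, Set.ncard_image_of_injective _ hinj]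
  funext g
  simp only [superchar]
  rw [horb, hcard]

theorem ncard_twoSidedOrbit_ne_zero {P : TriPoset n} (lam : NilDual F P) :
    (twoSidedOrbit lam).ncard ≠ 0 :=
  (Set.ncard_pos (Set.toFinite _)).2 ⟨lam, self_mem_twoSidedOrbit lam⟩ |>.ne'

theorem ncard_leftOrbit_ne_zero {P : TriPoset n} (lam : NilDual F P) :
    (leftOrbit lam).ncard ≠ 0 :=
  (Set.ncard_pos (Set.toFinite _)).2 ⟨lam, self_mem_leftOrbit lam⟩ |>.ne'

/-- A supercharacter, viewed on the algebra via `g ↦ g - 1`, combines distinct additive characters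
with a nonzero coefficient exactly on the orbit. Linear independence therefore recovers the orbit.
-/
theorem mem_orbit_of_superchar_eq {θ : AddChar F ℂ} (hθ : θ ≠ 1) {P : TriPoset n}
    {lam mu : NilDual F P} (h : superchar θ lam = superchar θ mu) : lam ∈ twoSidedOrbit mu := by
  classical
  have := Fintype.ofFinite (NilDual F P)
  have hli := (AddChar.linearIndependent (nil F P) ℂ).comp _ (dualChar_injective hθ P)
  rw [Fintype.linearIndependent_iff] at hli
  have hsum : ∀ (nu : NilDual F P) (g : patternGroup F P), superchar θ nu g =
      ∑ x, (if x ∈ twoSidedOrbit nu then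
        ((leftOrbit nu).ncard : ℂ) / ((twoSidedOrbit nu).ncard : ℂ) else 0) *
          dualChar θ x (subOne g) := by
    intro nu g
    rw [superchar, finsum_mem_eq_finite_toFinset_sum _ (Set.toFinite _), Finset.mul_sum]
    simp only [ite_mul, zero_mul]
    rw [← Finset.sum_filter]
    refine Finset.sum_congr (by ext; simp) fun x _ => rfl
  by_contra hnot
  have h0 := hli (fun x => (if x ∈ twoSidedOrbit lam then
      ((leftOrbit lam).ncard : ℂ) / ((twoSidedOrbit lam).ncard : ℂ) else 0) -
      (if x ∈ twoSidedOrbit mu then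
      ((leftOrbit mu).ncard : ℂ) / ((twoSidedOrbit mu).ncard : ℂ) else 0)) (by
    funext X
    obtain ⟨g, rfl⟩ := subOne_surjective P X
    have e := congrFun h g
    rw [hsum, hsum, ← sub_eq_zero, ← Finset.sum_sub_distrib] at e
    rw [Finset.sum_apply, Pi.zero_apply]
    refine Eq.trans ?_ e
    refine Finset.sum_congr rfl fun x _ => ?_
    rw [← sub_mul]
    rfl) lam
  rw [if_pos (self_mem_twoSidedOrbit lam), if_neg hnot, sub_zero, div_eq_zero_iff] at h0
  rcases h0 with h0 | h0
  · exact ncard_leftOrbit_ne_zero lam (by exact_mod_cast h0)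
  · exact ncard_twoSidedOrbit_ne_zero lam (by exact_mod_cast h0)

theorem superchar_one (θ : AddChar F ℂ) {P : TriPoset n} (lam : NilDual F P) :
    superchar θ lam 1 = (leftOrbit lam).ncard := by
  have h0 : (subOne (1 : patternGroup F P) : nil F P) = 0 := by
    apply Subtype.ext
    change (((1 : patternGroup F P) : GL (Fin n) F) : Matrix (Fin n) (Fin n) F) - 1 = 0
    simp
  have h1 : ∑ᶠ mu ∈ twoSidedOrbit lam, θ (mu (subOne (1 : patternGroup F P))) =
      ((twoSidedOrbit lam).ncard : ℂ) := by
    rw [h0, finsum_mem_eq_finite_toFinset_sum _ (Set.toFinite _)]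
    simp [Set.ncard_eq_toFinset_card _ (Set.toFinite (twoSidedOrbit lam))]
  rw [superchar, h1, div_mul_cancel₀]
  exact_mod_cast ncard_twoSidedOrbit_ne_zero lam

/-- The degree is the size of the left orbit, so degree one means that the left action fixes `λ`. -/
theorem superchar_one_eq_one_iff (θ : AddChar F ℂ) {P : TriPoset n} (lam : NilDual F P) :
    superchar θ lam 1 = 1 ↔ ∀ a ∈ patternGroup F P, ∀ j k, (j, k) ∈ P.rel →
      act a 1 (mat lam) j k = coord lam j k := by
  rw [superchar_one, Nat.cast_eq_one, Set.ncard_eq_one]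
  constructor
  · rintro ⟨mu, hmu⟩ a ha j k hjk
    have h1 : lam = mu := by simpa [hmu] using self_mem_leftOrbit lam
    have h2 : actL (⟨a, ha⟩⁻¹ : patternGroup F P) lam ∈ leftOrbit lam := ⟨_, rfl⟩
    rw [hmu, Set.mem_singleton_iff, ← h1] at h2
    have := coord_actL lam (⟨a, ha⟩⁻¹ : patternGroup F P) hjk
    rw [inv_inv, h2] at this
    exact this.symm
  · intro h
    refine ⟨lam, Set.eq_singleton_iff_unique_mem.2 ⟨self_mem_leftOrbit lam, ?_⟩⟩
    rintro _ ⟨g, rfl⟩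
    refine dual_ext fun j k hjk => ?_
    rw [coord_actL lam g hjk]
    exact h _ (g⁻¹).2 j k hjk

/-- Conjugation by `p` reduces to the left action on `λ`. A non-cover `(i, k)` of the support with
`j` between lets row `i` be added to row `j`, changing the entry at `(j, k)`. If the support
consists of covers, every such change falls outside `P`. -/
theorem supercharPair_one_eq_one_iff (θ : AddChar F ℂ) {P : TriPoset n} (hP : P.IsNormal)
    {lam : NilDual F P} (hlam : IsSetPartition lam) (eta : NilDual F P) :
    supercharPair θ lam eta 1 = 1 ↔ supp lam ⊆ P.cov := by
  obtain ⟨p, hp, q, hq, hpq⟩ := exists_act_eq_add_frakR hlam eta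
  rw [supercharPair, superchar_one_eq_one_iff]
  have hconj : ∀ a x : GL (Fin n) F, a = p⁻¹ * x * p →
      act a 1 (act p q (mat lam)) = act p q (act x 1 (mat lam)) := by
    rintro a x rfl
    simp only [act_act]
    congr 1 <;> group
  have hU : ∀ a ∈ patternGroup F P, a ∈ patternGroup F (TriPoset.full n) :=
    fun a ha => patternGroup_le_full P ha
  constructor
  · rintro h ⟨i, k⟩ hik
    refine ⟨hik.1, ?_⟩
    rintro ⟨j, hij, hjk⟩
    simp only at hij hjk
    obtain ⟨x, hx, hxe⟩ := exists_transvection (F := F) hij 1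
    have ha := conj_mem_patternGroup' hP hp hx
    have h1 := h _ ha j k hjk
    have h2 : act (p⁻¹ * x * p) 1 (mat (lam + frakR lam eta)) j k =
        act (p⁻¹ * x * p) 1 (act p q (mat lam)) j k :=
      act_congr_rel hP (hU _ ha) (Subgroup.one_mem _) hpq hjk
    have h3 : act x 1 (mat lam) = mat lam + Matrix.single j i (1 : F) * mat lam := by
      rw [act, hxe, Units.val_one, Matrix.transpose_one, mul_one, Matrix.transpose_add,
        Matrix.transpose_one, add_mul, one_mul, one_smul, Matrix.transpose_single]
    have h4 : ∀ i' l', i' ≤ j → k ≤ l' → (i', l') ≠ (j, k) →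
        (Matrix.single j i (1 : F) * mat lam : Matrix (Fin n) (Fin n) F) i' l' = 0 := by
      intro i' l' _ _ hne
      by_cases hi' : i' = j
      · subst hi'
        rw [Matrix.single_mul_apply_same, one_mul, mat_apply]
        by_contra h0
        exact hne (by rw [hlam.1 _ _ _ (mem_supp.2 h0) hik])
      · rw [Matrix.single_mul_apply_of_ne _ _ _ _ _ hi']
    rw [h2, hconj _ x rfl, h3, act_add, Matrix.add_apply, ← hpq j k hjk,
      act_apply_of_vanish hp hq h4, Matrix.single_mul_apply_same, one_mul, mat_apply,
      add_eq_left] at h1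
    exact mem_supp.1 hik h1
  · intro h a ha j k hjk
    have hx := conj_mem_patternGroup hP hp ha
    have h2 : act a 1 (mat (lam + frakR lam eta)) j k = act a 1 (act p q (mat lam)) j k :=
      act_congr_rel hP (hU _ ha) (Subgroup.one_mem _) hpq hjk
    rw [h2, hconj a (p * a * p⁻¹) (by group), hpq j k hjk]
    refine act_congr_rel hP hp hq (fun i l hil => ?_) hjk
    rw [act, Units.val_one, Matrix.transpose_one, mul_one, Matrix.mul_apply,
      Finset.sum_eq_single i]
    · rw [Matrix.transpose_apply, hx.1 i, one_mul]
    · intro m _ hm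
      by_cases hmi : (m, i) ∈ P.rel
      · have : coord lam m l = 0 := by
          by_contra h0
          exact (h (mem_supp.2 h0)).2 ⟨i, hmi, hil⟩
        rw [mat_apply, this, mul_zero]
      · rw [Matrix.transpose_apply, pattern_eq_zero hx hm hmi, zero_mul]
    · simp

end Characters

/-! ### Highest cover sets via the greedy choice -/

section Covers

variable {n : ℕ}

/-- The length `j - i` of a position `(i, j)`. -/
def len (p : Fin n × Fin n) : ℕ := (p.2 : ℕ) - (p.1 : ℕ)

/-- Turns lexicographic comparison into counting the entries that are at least `v`. The bound `1 ≤
v` keeps the zero padding out of the count. -/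
theorem le_getD_iff {v : ℕ} (hv : 1 ≤ v) (l : List ℕ) (hl : l.Pairwise (· ≥ ·)) (t : ℕ) :
    v ≤ l.getD t 0 ↔ t < l.countP (v ≤ ·) := by
  induction l generalizing t with
  | nil =>
    simp
    omega
  | cons a l ih =>
    rw [List.pairwise_cons] at hl
    by_cases ha : v ≤ a
    · rw [List.countP_cons_of_pos (by simpa using ha)]
      cases t with
      | zero => simpa using ha
      | succ t =>
        rw [List.getD_cons_succ, ih hl.2 t]
        omega
    · have hz : l.countP (v ≤ ·) = 0 := by
        rw [List.countP_eq_zero]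
        intro x hx
        have := hl.1 x hx
        simp only [decide_eq_true_eq]
        omega
      rw [List.countP_cons_of_neg (by simpa using ha), hz]
      cases t with
      | zero => simpa using ha
      | succ t =>
        rw [List.getD_cons_succ, ih hl.2 t, hz]
        simp

theorem le_ell_iff {v : ℕ} (hv : 1 ≤ v) (S : Finset (Fin n × Fin n)) (t : ℕ) :
    v ≤ ell S t ↔ t < (S.filter fun p => v ≤ len p).card := by
  rw [ell, le_getD_iff hv _ (Multiset.pairwise_sort _ _), ← Multiset.coe_countP,
    Multiset.sort_eq, Multiset.countP_map]
  rfl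

/-- Every element of `C` outside the independent set `S` shares a row or a column with a longer
element of `S`. -/
def IsDominant (C : Set (Fin n × Fin n)) (S : Finset (Fin n × Fin n)) : Prop :=
  ↑S ⊆ C ∧ Independent S ∧
    ∀ p ∈ C, p ∉ S → ∃ r ∈ S, (r.1 = p.1 ∨ r.2 = p.2) ∧ len p < len r

/-- Two conflicting positions of equal length coincide, so the greedy choice never meets a tie
between conflicting elements. -/
theorem eq_of_len_eq {p r : Fin n × Fin n} (hp : p.1 < p.2) (hr : r.1 < r.2)
    (h : r.1 = p.1 ∨ r.2 = p.2) (hl : len p = len r) : p = r := by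
  have h1 : (p.1 : ℕ) < p.2 := hp
  have h2 : (r.1 : ℕ) < r.2 := hr
  unfold len at hl
  rcases h with h | h
  · have h' : (r.1 : ℕ) = p.1 := by rw [h]
    exact Prod.ext h.symm (Fin.ext (by omega))
  · have h' : (r.2 : ℕ) = p.2 := by rw [h]
    exact Prod.ext (Fin.ext (by omega)) h.symm

theorem exists_isDominant_finset (C : Finset (Fin n × Fin n)) (hC : ∀ p ∈ C, p.1 < p.2) :
    ∃ S, IsDominant (C : Set (Fin n × Fin n)) S := by
  classical
  -- The inserted element is a shortest one, so elements are treated in decreasing length and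
  -- accepted unless blocked by a longer chosen one.
  induction C using Finset.induction_on_min_value len with
  | empty => exact ⟨∅, by simp, by simp [Independent], by simp⟩
  | insert a s has hmin ih =>
    obtain ⟨S, hS, hind, hdom⟩ := ih fun p hp => hC p (Finset.mem_insert_of_mem hp)
    by_cases hex : ∃ r ∈ S, (r.1 = a.1 ∨ r.2 = a.2) ∧ len a < len r
    · refine ⟨S, fun p hp => Finset.mem_insert_of_mem (hS hp), hind, fun p hp hpS => ?_⟩
      rcases Finset.mem_insert.1 hp with rfl | hp
      · exact hex
      · exact hdom p hp hpS
    · have hconf : ∀ r ∈ S, r.1 ≠ a.1 ∧ r.2 ≠ a.2 := by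
        intro r hr
        rw [← not_or]
        intro hc
        refine hex ⟨r, hr, hc, lt_of_le_of_ne (hmin r (hS hr)) fun hl => ?_⟩
        have := eq_of_len_eq (hC a (Finset.mem_insert_self _ _))
          (hC r (Finset.mem_insert_of_mem (hS hr))) hc hl
        exact has (this ▸ hS hr)
      refine ⟨insert a S, ?_, ?_, ?_⟩
      · rw [Finset.coe_insert, Finset.coe_insert]
        exact Set.insert_subset_insert hS
      · intro p hp r hr hne
        rcases Finset.mem_insert.1 hp with rfl | hp' <;> rcases Finset.mem_insert.1 hr with rfl | hr'
        · exact absurd rfl hne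
        · exact ⟨(hconf r hr').1.symm, (hconf r hr').2.symm⟩
        · exact hconf p hp'
        · exact hind p hp' r hr' hne
      · intro p hp hpS
        rw [Finset.mem_insert, not_or] at hpS
        rcases Finset.mem_insert.1 hp with h | hp
        · exact absurd h hpS.1
        · obtain ⟨r, hr, hr'⟩ := hdom p hp hpS.2
          exact ⟨r, Finset.mem_insert_of_mem hr, hr'⟩

theorem TriPoset.lt_of_mem_cov {Q : TriPoset n} {p : Fin n × Fin n} (hp : p ∈ Q.cov) :
    p.1 < p.2 := Q.lt_of_mem _ _ hp.1

theorem exists_isDominant (Q : TriPoset n) : ∃ S, IsDominant Q.cov S := by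
  obtain ⟨S, hS⟩ := exists_isDominant_finset (Set.toFinite Q.cov).toFinset
    fun p hp => TriPoset.lt_of_mem_cov ((Set.Finite.mem_toFinset _).1 hp)
  exact ⟨S, by simpa using hS⟩

/-- A dominant set is strictly lexicographically larger than all other independent sets. -/
theorem IsDominant.lex_lt {C : Set (Fin n × Fin n)} (hC : ∀ p ∈ C, p.1 < p.2)
    {S T : Finset (Fin n × Fin n)} (hS : IsDominant C S) (hTC : ↑T ⊆ C) (hT : Independent T)
    (hne : T ≠ S) : ∃ t, (∀ s < t, ell S s = ell T s) ∧ ell T t < ell S t := by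
  classical
  -- A longest element `p` of the symmetric difference lies in `S`: if it were in `T`, a longer
  -- element of `S` would conflict with it, and that element would also belong to `T`.
  obtain ⟨p, hp, hmax⟩ := Finset.exists_max_image (symmDiff S T) len
    (Finset.nonempty_iff_ne_empty.2 fun h => hne (symmDiff_eq_bot.1 h).symm)
  have hlong : ∀ r, len p < len r → (r ∈ S ↔ r ∈ T) := by
    intro r hr
    by_contra h
    refine absurd (hmax r ?_) (not_le.2 hr)
    rw [Finset.mem_symmDiff]
    tauto
  have hTS : ∀ r ∈ T, len p ≤ len r → r ∈ S := by
    intro r hr hle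
    by_contra hrS
    obtain ⟨w, hw, hc, hl⟩ := hS.2.2 r (hTC hr) hrS
    have hwT := (hlong w (hle.trans_lt hl)).1 hw
    have hd := hT w hwT r hr fun h => hrS (h ▸ hw)
    exact hc.elim hd.1 hd.2
  have hpS : p ∈ S ∧ p ∉ T := by
    rcases Finset.mem_symmDiff.1 hp with h | h
    · exact h
    · exact absurd (hTS p h.1 le_rfl) h.2
  have hpos : 1 ≤ len p := by
    have h1 : (p.1 : ℕ) < p.2 := hC p (hS.1 hpS.1)
    unfold len
    omega
  have heq : ∀ v, len p < v → (S.filter fun r => v ≤ len r) = T.filter fun r => v ≤ len r := by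
    intro v hv
    ext r
    simp only [Finset.mem_filter]
    exact and_congr_left fun h => hlong r (hv.trans_le h)
  have hlt : (T.filter fun r => len p ≤ len r).card < (S.filter fun r => len p ≤ len r).card := by
    refine Finset.card_lt_card ⟨fun r hr => ?_, fun h => ?_⟩
    · rw [Finset.mem_filter] at hr ⊢
      exact ⟨hTS r hr.1 hr.2, hr.2⟩
    · exact hpS.2 (Finset.mem_filter.1 (h (Finset.mem_filter.2 ⟨hpS.1, le_rfl⟩))).1
  -- The sequences first differ just after all the lengths of `T` that are at least `len p`; there
  -- `S` still has such a length.
  refine ⟨(T.filter fun r => len p ≤ len r).card, fun s hs => ?_, ?_⟩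
  · have h1 := (le_ell_iff hpos S s).2 (hs.trans hlt)
    have h2 := (le_ell_iff hpos T s).2 hs
    have key : ∀ v, len p < v → (v ≤ ell S s ↔ v ≤ ell T s) := by
      intro v hv
      rw [le_ell_iff (hpos.trans hv.le), le_ell_iff (hpos.trans hv.le), heq v hv]
    apply le_antisymm
    · rcases h1.lt_or_eq with h | h
      · exact (key _ h).1 le_rfl
      · exact h ▸ h2
    · rcases h2.lt_or_eq with h | h
      · exact (key _ h).2 le_rfl
      · exact h ▸ h1
  · have h1 := (le_ell_iff hpos S _).2 hlt
    have h2 := (le_ell_iff hpos T (T.filter fun r => len p ≤ len r).card).not.2 (lt_irrefl _)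
    omega

theorem IsDominant.covh_eq {Q : TriPoset n} {S : Finset (Fin n × Fin n)}
    (hS : IsDominant Q.cov S) : Q.covh = ↑S := by
  have hC : ∀ p ∈ Q.cov, p.1 < p.2 := fun p => TriPoset.lt_of_mem_cov
  ext p
  constructor
  · rintro ⟨T, ⟨⟨hTC, hT⟩, hmax⟩, hp⟩
    by_cases hne : T = S
    · exact hne ▸ hp
    obtain ⟨t, ht, hlt⟩ := hS.lex_lt hC hTC hT hne
    rcases hmax S hS.1 hS.2.1 with h | ⟨u, hu, hlt'⟩
    · rw [h] at hlt
      exact absurd hlt (lt_irrefl _)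
    · rcases lt_trichotomy t u with h | rfl | h
      · have := hu t h
        omega
      · omega
      · have := ht u h
        omega
  · intro hp
    refine ⟨S, ⟨⟨hS.1, hS.2.1⟩, fun T hTC hT => ?_⟩, hp⟩
    by_cases hne : T = S
    · exact Or.inl (by rw [hne])
    · exact Or.inr (hS.lex_lt hC hTC hT hne)

/-- Any non-cover splits at an intermediate point into two strictly shorter relations. -/
theorem TriPoset.mem_rel_iff_transGen (Q : TriPoset n) (i k : Fin n) :
    (i, k) ∈ Q.rel ↔ Relation.TransGen (fun a b => (a, b) ∈ Q.cov) i k := by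
  constructor
  · have key : ∀ m : ℕ, ∀ i k : Fin n, (k : ℕ) - i = m → (i, k) ∈ Q.rel →
        Relation.TransGen (fun a b => (a, b) ∈ Q.cov) i k := by
      intro m
      induction m using Nat.strong_induction_on with
      | _ m ih =>
        intro i k hm hik
        by_cases h : ∃ j, (i, j) ∈ Q.rel ∧ (j, k) ∈ Q.rel
        · obtain ⟨j, hij, hjk⟩ := h
          have h1 : (i : ℕ) < j := Q.lt_of_mem _ _ hij
          have h2 : (j : ℕ) < k := Q.lt_of_mem _ _ hjk
          exact (ih _ (by omega) i j rfl hij).trans (ih _ (by omega) j k rfl hjk)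
        · exact Relation.TransGen.single ⟨hik, h⟩
    exact key _ i k rfl
  · intro h
    induction h with
    | single h => exact h.1
    | tail _ h ih => exact Q.trans _ _ _ ih h.1

theorem TriPoset.eq_of_cov_eq {Q R : TriPoset n} (h : Q.cov = R.cov) : Q = R := by
  ext ⟨i, k⟩
  rw [mem_rel_iff_transGen, mem_rel_iff_transGen, h]

theorem isRepresentative_self (P : TriPoset n) : IsRepresentative P P := by
  obtain ⟨S, hS⟩ := exists_isDominant P
  refine ⟨subset_rfl, fun i j k hik hij hjk => ?_, fun i j k hik hjk hij => ?_⟩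
  · rw [hS.covh_eq] at hik
    exact (hS.1 hik).2 ⟨j, hij.1, hjk⟩
  · rw [hS.covh_eq] at hik
    exact (hS.1 hik).2 ⟨j, hij, hjk.1⟩

end Covers

/-! ### From pairs `(λ, η)` to representative labeled posets and back -/

section Correspondence

variable {F : Type*} [Field F] {n : ℕ}

theorem supp_add {P : TriPoset n} {lam eta : NilDual F P} (hlam : IsSetPartition lam)
    (heta : supp eta ⊆ coaux lam) : supp (lam + eta) = supp lam ∪ supp eta := by
  ext ⟨i, j⟩
  rw [Set.mem_union, mem_supp, mem_supp, mem_supp, coord_add]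
  by_cases h : coord lam i j = 0
  · simp [h]
  · have : coord eta i j = 0 := by
      by_contra h'
      exact notMem_coaux_of_mem_supp hlam (mem_supp.2 h) (heta (mem_supp.2 h'))
    simp [this]

theorem coord_eq_zero_of_mem_supp {P : TriPoset n} {lam eta : NilDual F P}
    (hlam : IsSetPartition lam) (heta : supp eta ⊆ coaux lam) {i j : Fin n}
    (h : (i, j) ∈ supp lam) : coord eta i j = 0 := by
  by_contra h'
  exact notMem_coaux_of_mem_supp hlam h (heta (mem_supp.2 h'))

/-- Each position of `η` lies in `coaux`, hence below or to the left of a support entry of `λ`,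
which is longer. So `supp λ` is dominant among the covers. -/
theorem covh_eq_supp {P Q : TriPoset n} {lam eta : NilDual F P} (hlam : IsSetPartition lam)
    (heta : supp eta ⊆ coaux lam) (hQ : Q.cov = supp (lam + eta)) : Q.covh = supp lam := by
  classical
  have hS : IsDominant Q.cov (Set.toFinite (supp lam)).toFinset := by
    refine ⟨?_, ?_, ?_⟩
    · rw [hQ, supp_add hlam heta, Set.Finite.coe_toFinset]
      exact Set.subset_union_left
    · rintro ⟨i, j⟩ hp ⟨k, l⟩ hr hne
      rw [Set.Finite.mem_toFinset] at hp hr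
      constructor
      · rintro h
        simp only at h
        subst h
        exact hne (by rw [hlam.1 _ _ _ hp hr])
      · rintro h
        simp only at h
        subst h
        exact hne (by rw [hlam.2 _ _ _ hp hr])
    · rintro ⟨i, j⟩ hp hpS
      rw [Set.Finite.mem_toFinset] at hpS
      rw [hQ, supp_add hlam heta] at hp
      obtain ⟨h1, h2, -⟩ := mem_coaux_iff.1 (heta (hp.resolve_left hpS))
      have h1' : (i : ℕ) < j := P.lt_of_mem _ _ h1
      rcases h2 with ⟨h, hi, hs⟩ | ⟨k, hk, hs⟩
      · refine ⟨(h, j), (Set.Finite.mem_toFinset _).2 hs, Or.inr rfl, ?_⟩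
        have : (h : ℕ) < i := hi
        simp only [len]
        omega
      · refine ⟨(i, k), (Set.Finite.mem_toFinset _).2 hs, Or.inl rfl, ?_⟩
        have : (j : ℕ) < k := hk
        simp only [len]
        omega
  rw [hS.covh_eq, Set.Finite.coe_toFinset]

/-- The poset generated by a set of positions. -/
def TriPoset.generate (C : Set (Fin n × Fin n)) (hC : ∀ i j, (i, j) ∈ C → i < j) :
    TriPoset n where
  rel := {p | Relation.TransGen (fun a b => (a, b) ∈ C) p.1 p.2}
  lt_of_mem := by
    intro i j h
    change Relation.TransGen (fun a b => (a, b) ∈ C) i j at h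
    induction h with
    | single h => exact hC _ _ h
    | tail _ h ih => exact ih.trans (hC _ _ h)
  trans := fun _ _ _ h h' => Relation.TransGen.trans h h'

theorem TriPoset.mem_generate {C : Set (Fin n × Fin n)} {hC : ∀ i j, (i, j) ∈ C → i < j}
    {i j : Fin n} : (i, j) ∈ (TriPoset.generate C hC).rel ↔
      Relation.TransGen (fun a b => (a, b) ∈ C) i j := Iff.rfl

theorem TriPoset.cov_generate {C : Set (Fin n × Fin n)} (hC : ∀ i j, (i, j) ∈ C → i < j)
    (h : ∀ i j k, (i, k) ∈ C → Relation.TransGen (fun a b => (a, b) ∈ C) i j →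
      Relation.TransGen (fun a b => (a, b) ∈ C) j k → False) :
    (TriPoset.generate C hC).cov = C := by
  ext ⟨i, k⟩
  constructor
  · rintro ⟨h1, h2⟩
    rcases Relation.TransGen.tail'_iff.1 (mem_generate.1 h1) with ⟨j, hij, hjk⟩
    rcases Relation.reflTransGen_iff_eq_or_transGen.1 hij with rfl | hij
    · exact hjk
    · exact absurd ⟨j, hij, Relation.TransGen.single hjk⟩ h2
  · intro hik
    exact ⟨Relation.TransGen.single hik, fun ⟨j, hij, hjk⟩ => h i j k hik hij hjk⟩

/-- The support of `λ + η` contains no position composed of others. -/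
theorem supp_add_irredundant {P : TriPoset n} (hP : P.IsNormal) {lam eta : NilDual F P}
    (hlam : IsSetPartition lam) (heta : supp eta ⊆ coaux lam) (i j k : Fin n)
    (hik : (i, k) ∈ supp (lam + eta))
    (hij : Relation.TransGen (fun a b => (a, b) ∈ supp (lam + eta)) i j)
    (hjk : Relation.TransGen (fun a b => (a, b) ∈ supp (lam + eta)) j k) : False := by
  have hsub : ∀ a b, Relation.TransGen (fun a b => (a, b) ∈ supp (lam + eta)) a b →
      (a, b) ∈ P.rel := by
    intro a b h
    induction h with
    | single h => exact h.1
    | tail _ h ih => exact P.trans _ _ _ ih h.1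
  -- Compare only the first step `(i, s)` and last step `(t, k)` of the chain with the support entry
  -- in row `i` or column `k`; membership in `coaux` forbids `(s, k)` or `(i, t)`, extended outward
  -- by normality.
  obtain ⟨s, his, hsj⟩ := Relation.TransGen.head'_iff.1 hij
  obtain ⟨t, hjt, htk⟩ := Relation.TransGen.tail'_iff.1 hjk
  have hsk := hsub _ _ (Relation.TransGen.trans_right hsj hjk)
  have hit := hsub _ _ (Relation.TransGen.trans_left hij hjt)
  rw [supp_add hlam heta] at hik his htk
  have hrow : ∀ l, (i, l) ∈ supp lam → l = s ∨ (s, l) ∉ P.rel := by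
    intro l hl
    rcases his with h | h
    · exact Or.inl (hlam.1 _ _ _ hl h)
    · exact Or.inr ((mem_coaux_iff.1 (heta h)).2.2.2 l hl)
  have hcol : ∀ h, (h, k) ∈ supp lam → h = t ∨ (h, t) ∉ P.rel := by
    intro l hl
    rcases htk with h | h
    · exact Or.inl (hlam.2 _ _ _ hl h)
    · exact Or.inr ((mem_coaux_iff.1 (heta h)).2.2.1 l hl)
  rcases hik with hik | hik
  · rcases hrow k hik with rfl | h
    · exact lt_irrefl _ (P.lt_of_mem _ _ hsk)
    · exact h hsk
  · rcases (mem_coaux_iff.1 (heta hik)).2.1 with ⟨h, hi, hs⟩ | ⟨l, hl, hs⟩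
    · rcases hcol h hs with rfl | h'
      · exact lt_asymm hi (P.lt_of_mem _ _ hit)
      · exact h' (hP.mem hit hi.le le_rfl)
    · rcases hrow l hs with rfl | h'
      · exact lt_asymm hl (P.lt_of_mem _ _ hsk)
      · exact h' (hP.mem hsk le_rfl hl.le)

theorem isRepresentative_of_cov_eq {P Q : TriPoset n} {lam eta : NilDual F P}
    (hlam : IsSetPartition lam) (heta : supp eta ⊆ coaux lam) (hQ : Q.cov = supp (lam + eta)) :
    IsRepresentative P Q := by
  have hcovh := covh_eq_supp hlam heta hQ
  refine ⟨?_, ?_, ?_⟩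
  · rintro ⟨i, j⟩ h
    rw [TriPoset.mem_rel_iff_transGen, hQ] at h
    induction h with
    | single h => exact h.1
    | tail _ h ih => exact P.trans _ _ _ ih h.1
  · intro i j k hik hij hjk
    rw [hcovh] at hik
    rw [hQ, supp_add hlam heta] at hij
    rcases hij with h | h
    · rw [hlam.1 _ _ _ hik h] at hjk
      exact lt_irrefl _ (P.lt_of_mem _ _ hjk)
    · exact (mem_coaux_iff.1 (heta h)).2.2.2 k hik hjk
  · intro i j k hik hjk hij
    rw [hcovh] at hik
    rw [hQ, supp_add hlam heta] at hjk
    rcases hjk with h | h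
    · rw [hlam.2 _ _ _ hik h] at hij
      exact lt_irrefl _ (P.lt_of_mem _ _ hij)
    · exact (mem_coaux_iff.1 (heta h)).2.2.1 i hik hij

theorem LabeledPoset.entry_of_mem (Q : LabeledPoset n F) {i j : Fin n}
    (h : (i, j) ∈ Q.poset.cov) : Q.entry i j = Q.label ⟨(i, j), h⟩ := dif_pos h

theorem LabeledPoset.entry_of_notMem (Q : LabeledPoset n F) {i j : Fin n}
    (h : (i, j) ∉ Q.poset.cov) : Q.entry i j = 0 := dif_neg h

theorem LabeledPoset.entry_ne_zero_iff (Q : LabeledPoset n F) {i j : Fin n} :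
    Q.entry i j ≠ 0 ↔ (i, j) ∈ Q.poset.cov := by
  by_cases h : (i, j) ∈ Q.poset.cov
  · simp [Q.entry_of_mem h, h]
  · simp [Q.entry_of_notMem h, h]

theorem LabeledPoset.eq_of_entry_eq {Q R : LabeledPoset n F}
    (h : ∀ i j, Q.entry i j = R.entry i j) : Q = R := by
  have hcov : Q.poset.cov = R.poset.cov := by
    ext ⟨i, j⟩
    rw [← Q.entry_ne_zero_iff, h, R.entry_ne_zero_iff]
  obtain ⟨q, a⟩ := Q
  obtain ⟨r, b⟩ := R
  obtain rfl : q = r := TriPoset.eq_of_cov_eq hcov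
  congr 1
  funext ⟨⟨i, j⟩, hij⟩
  apply Units.ext
  have := h i j
  rwa [LabeledPoset.entry_of_mem _ hij, LabeledPoset.entry_of_mem _ hij] at this

theorem exists_isPosetOf {P : TriPoset n} (hP : P.IsNormal) {lam eta : NilDual F P}
    (hlam : IsSetPartition lam) (heta : supp eta ⊆ coaux lam) :
    ∃ Q : LabeledPoset n F, IsPosetOf lam eta Q := by
  have hC : ∀ i j, (i, j) ∈ supp (lam + eta) → i < j := fun i j h => P.lt_of_mem _ _ h.1
  have hcov := TriPoset.cov_generate hC (supp_add_irredundant hP hlam heta)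
  have hne : ∀ p : (TriPoset.generate _ hC).cov, coord (lam + eta) p.1.1 p.1.2 ≠ 0 := by
    rintro ⟨⟨i, j⟩, hp⟩
    rw [hcov] at hp
    exact mem_supp.1 hp
  refine ⟨⟨TriPoset.generate _ hC, fun p => Units.mk0 _ (hne p)⟩, hcov, fun i j => ?_⟩
  by_cases h : (i, j) ∈ (TriPoset.generate _ hC).cov
  · rw [LabeledPoset.entry_of_mem _ h]
    rfl
  · rw [LabeledPoset.entry_of_notMem _ h]
    rw [hcov, mem_supp, not_not] at h
    exact h.symm

/-- The poset determines `supp λ` as `covh`; the labels there give `λ`, and subtracting it from the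
label matrix gives `η`. -/
theorem isPosetOf_unique {P : TriPoset n} {lam eta mu zeta : NilDual F P} {Q : LabeledPoset n F}
    (hlam : IsSetPartition lam) (heta : supp eta ⊆ coaux lam) (hmu : IsSetPartition mu)
    (hzeta : supp zeta ⊆ coaux mu) (h : IsPosetOf lam eta Q) (h' : IsPosetOf mu zeta Q) :
    lam = mu ∧ eta = zeta := by
  have hs : supp lam = supp mu := by
    rw [← covh_eq_supp hlam heta h.1, covh_eq_supp hmu hzeta h'.1]
  have hsum : ∀ i j, coord lam i j + coord eta i j = coord mu i j + coord zeta i j := by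
    intro i j
    rw [← coord_add, ← coord_add, ← h.2, h'.2]
  have hlm : lam = mu := by
    refine dual_ext fun i j _ => ?_
    by_cases hij : (i, j) ∈ supp lam
    · have e := hsum i j
      rwa [coord_eq_zero_of_mem_supp hlam heta hij, coord_eq_zero_of_mem_supp hmu hzeta (hs ▸ hij),
        add_zero, add_zero] at e
    · have hij' := hij
      rw [hs] at hij'
      rw [mem_supp, not_not] at hij hij'
      rw [hij, hij']
  refine ⟨hlm, dual_ext fun i j _ => ?_⟩
  have e := hsum i j
  rw [hlm] at e
  exact add_left_cancel e

/-- A representative labeled poset comes from a pair `(λ, η)`. -/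
theorem exists_pair_of_isRepresentative {P : TriPoset n} {Q : LabeledPoset n F}
    (hQ : IsRepresentative P Q.poset) : ∃ lam eta : NilDual F P, IsSetPartition lam ∧
      supp eta ⊆ coaux lam ∧ IsPosetOf lam eta Q := by
  classical
  obtain ⟨S, hS⟩ := exists_isDominant Q.poset
  have hcovh := hS.covh_eq
  -- The labels are split: `λ` takes those on the highest cover set and `η` the others.
  set lam : NilDual F P := ofMatrix fun i j => if (i, j) ∈ S then Q.entry i j else 0 with hlamdef
  set eta : NilDual F P := ofMatrix fun i j => if (i, j) ∈ S then 0 else Q.entry i j with hetadef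
  have hnot : ∀ i j, (i, j) ∉ P.rel → Q.entry i j = 0 := by
    intro i j h
    by_contra h'
    exact h (hQ.1 (Q.entry_ne_zero_iff.1 h').1)
  have hl : ∀ i j, coord lam i j = if (i, j) ∈ S then Q.entry i j else 0 := by
    intro i j
    by_cases h : (i, j) ∈ P.rel
    · rw [hlamdef, coord_ofMatrix _ h]
    · rw [coord_of_notMem _ h, hnot i j h, ite_self]
  have he : ∀ i j, coord eta i j = if (i, j) ∈ S then 0 else Q.entry i j := by
    intro i j
    by_cases h : (i, j) ∈ P.rel
    · rw [hetadef, coord_ofMatrix _ h]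
    · rw [coord_of_notMem _ h, hnot i j h, ite_self]
  have hsl : ∀ i j, (i, j) ∈ supp lam ↔ (i, j) ∈ S := by
    intro i j
    rw [mem_supp, hl]
    by_cases h : (i, j) ∈ S
    · simpa [h] using Q.entry_ne_zero_iff.2 (hS.1 h)
    · simp [h]
  have hse : ∀ i j, (i, j) ∈ supp eta → (i, j) ∉ S ∧ (i, j) ∈ Q.poset.cov := by
    intro i j hij
    rw [mem_supp, he] at hij
    by_cases h : (i, j) ∈ S
    · simp [h] at hij
    · rw [if_neg h, Q.entry_ne_zero_iff] at hij
      exact ⟨h, hij⟩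
  have hsum : ∀ i j, coord (lam + eta) i j = Q.entry i j := by
    intro i j
    rw [coord_add, hl, he]
    split_ifs <;> simp
  refine ⟨lam, eta, ⟨fun i j k hij hik => ?_, fun i j k hik hjk => ?_⟩, ?_, ?_,
    fun i j => (hsum i j).symm⟩
  · by_contra h
    exact (hS.2.1 _ ((hsl _ _).1 hij) _ ((hsl _ _).1 hik) (by simpa using h)).1 rfl
  · by_contra h
    exact (hS.2.1 _ ((hsl _ _).1 hik) _ ((hsl _ _).1 hjk) (by simpa using h)).2 rfl
  · rintro ⟨i, j⟩ h
    obtain ⟨hnS, hc⟩ := hse i j h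
    refine mem_coaux_iff.2 ⟨hQ.1 hc.1, ?_, fun h hs => ?_, fun k hs => ?_⟩
    -- A longer chosen cover in the same row or column puts the position in `coadj` for the full
    -- poset; representativity, used next, keeps it out of `coadj P`.
    · obtain ⟨⟨a, b⟩, hr, hab, hlen⟩ := hS.2.2 _ hc hnS
      simp only [len] at hab hlen
      rcases hab with rfl | rfl
      · exact Or.inr ⟨b, by change (j : ℕ) < b; omega, (hsl _ _).2 hr⟩
      · exact Or.inl ⟨a, by change (a : ℕ) < i; omega, (hsl _ _).2 hr⟩
    · exact hQ.2.2 h i j (hcovh ▸ (hsl _ _).1 hs) hc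
    · exact hQ.2.1 i j k (hcovh ▸ (hsl _ _).1 hs) hc
  · ext ⟨i, j⟩
    rw [mem_supp, hsum, Q.entry_ne_zero_iff]

/-- A position of `η` that factors through some `j` in `P` lies below or to the left of a support
entry of `λ`, and by normality that entry factors through the same `j`. -/
theorem supp_add_subset_cov_iff {P : TriPoset n} (hP : P.IsNormal) {lam eta : NilDual F P}
    (hlam : IsSetPartition lam) (heta : supp eta ⊆ coaux lam) :
    supp (lam + eta) ⊆ P.cov ↔ supp lam ⊆ P.cov := by
  rw [supp_add hlam heta, Set.union_subset_iff]
  refine ⟨fun h => h.1, fun h => ⟨h, ?_⟩⟩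
  rintro ⟨i, k⟩ hik
  refine ⟨hik.1, ?_⟩
  rintro ⟨j, hij, hjk⟩
  rcases (mem_coaux_iff.1 (heta hik)).2.1 with ⟨a, ha, hs⟩ | ⟨b, hb, hs⟩
  · exact (h hs).2 ⟨j, hP.mem hij ha.le le_rfl, hjk⟩
  · exact (h hs).2 ⟨j, hij, hP.mem hjk le_rfl hb.le⟩

end Correspondence

end PatternGroup

/-! ### The bijection and the degree-one supercharacters -/

theorem mainTheorem7 {F : Type*} [Field F] [Finite F] (θ : AddChar F ℂ) (hθ : θ ≠ 1)
    (n : ℕ) (P : PatternGroup.TriPoset n) (hP : P.IsNormal) :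
    -- the correspondence is a bijection from supercharacters to representative labeled posets
    ((∀ χ : PatternGroup.patternGroup F P → ℂ, PatternGroup.IsSupercharacter θ χ →
        ∃! Q : PatternGroup.LabeledPoset n F,
          PatternGroup.IsRepresentative P Q.poset ∧ PatternGroup.Corresponds θ χ Q) ∧
      (∀ Q : PatternGroup.LabeledPoset n F, PatternGroup.IsRepresentative P Q.poset →
        ∃! χ : PatternGroup.patternGroup F P → ℂ,
          PatternGroup.IsSupercharacter θ χ ∧ PatternGroup.Corresponds θ χ Q)) ∧
    -- part (a)
    (∀ a : P.cov → Fˣ,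
      PatternGroup.IsRepresentative P P ∧
        ∃ χ : PatternGroup.patternGroup F P → ℂ,
          PatternGroup.IsSupercharacter θ χ ∧ PatternGroup.Corresponds θ χ ⟨P, a⟩ ∧ χ 1 = 1) ∧
    -- part (b)
    (∀ χ : PatternGroup.patternGroup F P → ℂ, PatternGroup.IsSupercharacter θ χ →
      (χ 1 = 1 ↔ ∃ Q : PatternGroup.LabeledPoset n F,
        PatternGroup.IsRepresentative P Q.poset ∧ PatternGroup.Corresponds θ χ Q ∧
          Q.poset.cov ⊆ P.cov)) := by
  have hpair : ∀ χ : PatternGroup.patternGroup F P → ℂ, PatternGroup.IsSupercharacter θ χ →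
      ∃ lam eta : PatternGroup.NilDual F P, PatternGroup.IsSetPartition lam ∧
        PatternGroup.supp eta ⊆ PatternGroup.coaux lam ∧
        χ = PatternGroup.supercharPair θ lam eta := by
    rintro _ ⟨mu, rfl⟩
    obtain ⟨lam, eta, hlam, heta, h⟩ := PatternGroup.exists_pair_mem_orbit hP mu
    exact ⟨lam, eta, hlam, heta, (PatternGroup.superchar_eq_of_mem_orbit θ h).symm⟩
  have hcorr : ∀ χ : PatternGroup.patternGroup F P → ℂ, PatternGroup.IsSupercharacter θ χ →
      ∃ Q : PatternGroup.LabeledPoset n F,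
        PatternGroup.IsRepresentative P Q.poset ∧ PatternGroup.Corresponds θ χ Q := by
    intro χ hχ
    obtain ⟨lam, eta, hlam, heta, hχe⟩ := hpair χ hχ
    obtain ⟨Q, hQ⟩ := PatternGroup.exists_isPosetOf hP hlam heta
    exact ⟨Q, PatternGroup.isRepresentative_of_cov_eq hlam heta hQ.1, lam, eta, hlam, heta, hχe, hQ⟩
  have hdeg : ∀ (χ : PatternGroup.patternGroup F P → ℂ) (Q : PatternGroup.LabeledPoset n F),
      PatternGroup.Corresponds θ χ Q → (χ 1 = 1 ↔ Q.poset.cov ⊆ P.cov) := by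
    rintro χ Q ⟨lam, eta, hlam, heta, rfl, hQ⟩
    rw [hQ.1, PatternGroup.supp_add_subset_cov_iff hP hlam heta,
      PatternGroup.supercharPair_one_eq_one_iff θ hP hlam]
  refine ⟨⟨fun χ hχ => ?_, fun Q hQ => ?_⟩, fun a => ?_, fun χ hχ => ⟨fun h1 => ?_, ?_⟩⟩
  · obtain ⟨Q, hQ, hc⟩ := hcorr χ hχ
    refine ⟨Q, ⟨hQ, hc⟩, ?_⟩
    rintro R ⟨-, mu, zeta, hmu, hzeta, hχ', hR⟩
    obtain ⟨lam, eta, hlam, heta, hχe, hQe⟩ := hc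
    obtain ⟨rfl, rfl⟩ := PatternGroup.pair_unique hP hlam hmu heta hzeta
      (PatternGroup.mem_orbit_of_superchar_eq hθ (hχ'.symm.trans hχe))
    exact PatternGroup.LabeledPoset.eq_of_entry_eq fun i j => by rw [hR.2, hQe.2]
  · obtain ⟨lam, eta, hlam, heta, hQe⟩ := PatternGroup.exists_pair_of_isRepresentative hQ
    refine ⟨PatternGroup.supercharPair θ lam eta, ⟨⟨_, rfl⟩, lam, eta, hlam, heta, rfl, hQe⟩, ?_⟩
    rintro χ ⟨-, mu, zeta, hmu, hzeta, rfl, hQ'⟩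
    obtain ⟨rfl, rfl⟩ := PatternGroup.isPosetOf_unique hlam heta hmu hzeta hQe hQ'
    rfl
  · have hrep := PatternGroup.isRepresentative_self P
    obtain ⟨lam, eta, hlam, heta, hQe⟩ :=
      PatternGroup.exists_pair_of_isRepresentative (Q := ⟨P, a⟩) hrep
    have hc : PatternGroup.Corresponds θ (PatternGroup.supercharPair θ lam eta) ⟨P, a⟩ :=
      ⟨lam, eta, hlam, heta, rfl, hQe⟩
    exact ⟨hrep, _, ⟨_, rfl⟩, hc, (hdeg _ _ hc).2 subset_rfl⟩
  · obtain ⟨Q, hQ, hc⟩ := hcorr χ hχ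
    exact ⟨Q, hQ, hc, (hdeg χ Q hc).1 h1⟩
  · rintro ⟨Q, -, hc, hcov⟩
    exact (hdeg χ Q hc).2 hcov
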